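/- Let $\mathbb{F}_q$ be a finite field, let $r,m\ge 1$ be integers with $\gcd(r,m)=1$ and $m$ not divisible by the characteristic of $\mathbb{F}_q$, and let $\alpha_1,\dots,\alpha_r\in\mathbb{F}_q$ be pairwise distinct. Let $F=\mathbb{F}_q(x,y)$ be the function field, with $y$ transcendental over $\mathbb{F}_q$, given by the Kummer extension $F/\mathbb{F}_q(y)$ with $$\prod_{i=1}^r (y-\alpha_i)=x^m ,$$ and let $g$ be its genus. For each root $b$ of $\prod_{i=1}^r(b-\alpha_i)=0$ there is exactly one place of $F$ at which $x$ and $y-b$ both vanish; denote it by $P_{0b}$. A divisor $A$ is non-special if $\ell(A)=\deg A+1-g$, where $\ell(A)$ is the dimension over $\mathbb{F}_q$ of $\mathcal{L}(A)=\{f\in F^\times:(f)\ge -A\}\cup\{0\}$. Put $\gamma=m-1-\lfloor m/r\rfloor$ and, for $1\le j\le\gamma$, $$l_j=r-\left\lfloor \frac{rj}{m}\right\rfloor,\qquad s_j=l_j-l_{j+1}\ \text{ if } j<\gamma,\qquad s_\gamma=l_\gamma-1 .$$ If $\gamma\ge 1$, then $s_\gamma=\max\{1,\lfloor r/m\rfloor\}$.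 A divisor $A$ of $F$ is an effective non-special divisor of degree $g$ with support contained in $\{P_{0b}:\prod_{i=1}^r(b-\alpha_i)=0\}$ if and only if $$A=\sum_{j=1}^{\gamma} j\sum_{i=1}^{s_j}P_{0b_{j_i}}$$ for some pairwise distinct elements $b_{j_i}$ ($1\le j\le\gamma$, $1\le i\le s_j$) of $\{\alpha_1,\dots,\alpha_r\}$ (an empty sum is $0$). In particular, if $r<m$, these divisors are exactly the divisors $$A=\sum_{j=1}^{r-1}\left\lfloor\frac{jm}{r}\right\rfloor P_{0b_j}$$ with $b_1,\dots,b_{r-1}$ pairwise distinct elements of $\{\alpha_1,\dots,\alpha_r\}$. -/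

import Mathlib

open scoped WithZero

noncomputable section

namespace KummerDivisor

/-- A place of the function field `F / K`, given by its normalized discrete valuation, written
multiplicatively: `v f = exp (-n)` means that `f` has order `n` at the place, and `v 0 = 0`.
The valuation is onto and is trivial on the constants. -/
@[ext]
structure Place (K F : Type*) [Field K] [Field F] [Algebra K F] where
  v : Valuation F ℤᵐ⁰
  surjective : Function.Surjective v
  trivial_on_constants : ∀ c : K, c ≠ 0 → v (algebraMap K F c) = 1

variable {K F : Type*} [Field K] [Field F] [Algebra K F]

lemma Place.v_algebraMap_le_one (P : Place K F) (c : K) : P.v (algebraMap K F c) ≤ 1 := by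
  by_cases hc : c = 0
  · simp [hc]
  · exact (P.trivial_on_constants c hc).le

/-- The valuation ring `𝒪_P`. -/
def Place.valuationRing (P : Place K F) : Subalgebra K F where
  carrier := {f | P.v f ≤ 1}
  mul_mem' := fun {f g} hf hg => by
    have h : P.v (f * g) = P.v f * P.v g := map_mul P.v f g
    exact h.le.trans (mul_le_one' hf hg)
  add_mem' := fun {f g} hf hg => (P.v.map_add f g).trans (max_le hf hg)
  algebraMap_mem' := P.v_algebraMap_le_one

/-- The maximal ideal of `𝒪_P`: the functions that vanish at `P`. -/
def Place.maximalIdeal (P : Place K F) : Ideal P.valuationRing where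
  carrier := {f | P.v (f : F) < 1}
  add_mem' := fun {f g} hf hg => P.v.map_add_lt hf hg
  zero_mem' := by simp
  smul_mem' := fun c f hf => by
    have hc : P.v (c : F) ≤ 1 := c.2
    have hf' : P.v (f : F) < 1 := hf
    have h : P.v ((c • f : P.valuationRing) : F) = P.v (c : F) * P.v (f : F) := by
      simp
    exact h.le.trans_lt ((mul_le_of_le_one_left' hc).trans_lt hf')

/-- The degree of a place: the dimension over `K` of its residue class field. -/
def Place.degree (P : Place K F) : ℕ := Module.finrank K (P.valuationRing ⧸ P.maximalIdeal)

/-- `P` lies over the affine point `(a, b)`: both `x - a` and `y - b` vanish at `P`. -/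
def Place.IsAt (P : Place K F) (x y : F) (a b : K) : Prop :=
  P.v (x - algebraMap K F a) < 1 ∧ P.v (y - algebraMap K F b) < 1

variable (K F) in
/-- Divisors: formal finite integer combinations of places. -/
abbrev Divisor : Type _ := Place K F →₀ ℤ

/-- The degree of a divisor. -/
def Divisor.degree (A : Divisor K F) : ℤ := A.sum fun P n => n * (P.degree : ℤ)

/-- The Riemann–Roch space `ℒ(A)`: `f = 0` or `f` has order at least `-A(P)` at every `P`. -/
def riemannRochSpace (A : Divisor K F) : Submodule K F where
  carrier := {f | ∀ P : Place K F, P.v f ≤ WithZero.exp (A P)}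
  add_mem' := fun {f g} hf hg P => (P.v.map_add f g).trans (max_le (hf P) (hg P))
  zero_mem' := fun P => by simp
  smul_mem' := fun c f hf P => by
    have h : P.v (c • f) = P.v (algebraMap K F c) * P.v f := by
      rw [Algebra.smul_def, map_mul]
    exact h.le.trans ((mul_le_of_le_one_left' (P.v_algebraMap_le_one c)).trans (hf P))

/-- `ℓ(A) = dim ℒ(A)`. -/
def ell (A : Divisor K F) : ℕ := Module.finrank K (riemannRochSpace A)

variable (K F) in
/-- The genus: the maximum over all divisors `A` of `deg A - ℓ(A) + 1`. -/
def genus : ℤ := sSup (Set.range fun A : Divisor K F => A.degree - (ell A : ℤ) + 1)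

/-- The index of specialty `i(A) = ℓ(A) - (deg A + 1 - g)`. -/
def indexOfSpecialty (A : Divisor K F) : ℤ := (ell A : ℤ) - (A.degree + 1 - genus K F)

/-- `A` is non-special if its index of specialty is zero. -/
def IsNonspecial (A : Divisor K F) : Prop := indexOfSpecialty A = 0

/-- `A` is an effective non-special divisor of degree `g` whose support is contained in the set
of places `P_{0b}` with `∏ i, (b - α i) = 0`. -/
def IsEffectiveNonspecialOverZero {r : ℕ} (α : Fin r → K) (x y : F) (A : Divisor K F) : Prop :=
  0 ≤ A ∧ IsNonspecial A ∧ A.degree = genus K F ∧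
    ∀ Q ∈ A.support, ∃ b : K, ∏ i, (b - α i) = 0 ∧ Q.IsAt x y 0 b

/-- The largest index `m - 1 - ⌊m / r⌋` (the true value is `-1` if `r = 1`; the range
`1 ≤ j ≤ gam r m` is empty then as well). -/
def gam (r m : ℕ) : ℕ := m - 1 - m / r

/-- `l_j = r - ⌊r j / m⌋`, used for `1 ≤ j < m` only, so that the subtraction is exact. -/
def lval (r m j : ℕ) : ℕ := r - r * j / m

/-- `s_j = l_j - l_{j+1}` below the largest index, and `s_j = l_j - 1` at the largest index. -/
def sval (r m j : ℕ) : ℕ :=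
  if j < gam r m then lval r m j - lval r m (j + 1) else lval r m j - 1

end KummerDivisor

end

/-! ### Places arising from maximal ideals of a Dedekind domain -/

noncomputable section

namespace KummerDivisor

open WithZero IsDedekindDomain

/-! Let `P_i` be the place over `y = α i` and `P_∞` the pole of `y`; they are totally ramified over
`K(y)`, with `x` of order `1` and `-r` respectively. Write `f = ∑ g_k x^k` with `k < m` and `g_k ∈
K(y)`. At each of these places the orders of the terms are distinct modulo `m`, so nothing cancels
and the condition `f ∈ ℒ(A)` splits into conditions on the single `g_k`
(`IsKummer.exists_eq_sum_of_mem`). For `A = ∑ a_i P_i + n P_∞` this gives `ℓ(A) = ∑_k max(0, 1 + ∑_i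
⌊(a_i + k)/m⌋ + ⌊(n - rk)/m⌋)` (`IsKummer.finite_and_ell_divisor`).

For `A = mN P_∞` with `N` large, `deg A - ℓ(A) + 1` equals `∑_{k<m} ⌊rk/m⌋`. Every divisor lies
below one that is linearly equivalent, up to degree, to such a multiple of `P_∞`, and `deg - ℓ` is
monotone; hence this sum is the genus (`IsKummer.genus_eq`).

An effective divisor of degree `g` is non-special iff `ℓ = 1`. For `A = ∑ a_i P_i` the dimension
formula turns this into `a_i < m` and `∑_i ⌊(a_i + k)/m⌋ ≤ ⌊rk/m⌋` for `0 < k < m`. The left side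
counts the `i` with `a_i ≥ m - k`, and these counts add up to `∑ a_i = g = ∑_k ⌊rk/m⌋`. So all
inequalities are equalities: the condition is `#{i : a_i ≥ j} = ⌊r(m - j)/m⌋` for every `j ≥ 1`
(`card_filter_eq_iff`). Such a counting function determines the `a_i` up to a permutation of the
places, and both explicit families have exactly this one (`card_filter_sigma`, `card_filter_Icc`).
-/

/-- Two equivalent valuations onto `ℤᵐ⁰` are equal. -/
lemma eq_of_isEquiv_of_surjective {F : Type*} [Field F] {v w : Valuation F ℤᵐ⁰}
    (hv : Function.Surjective v) (hw : Function.Surjective w) (h : v.IsEquiv w) : v = w := by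
  obtain ⟨π, hπ⟩ := hv (exp (-1))
  have hπ0 : π ≠ 0 := by rintro rfl; exact exp_ne_zero (hπ.symm.trans (map_zero v))
  have hwπ0 : w π ≠ 0 := (Valuation.ne_zero_iff _).2 hπ0
  obtain ⟨k, hk⟩ : ∃ k : ℤ, w π = exp k := ⟨log (w π), (exp_log hwπ0).symm⟩
  have hk0 : k < 0 := by
    have : w π < 1 := h.lt_one_iff_lt_one.1 (by rw [hπ, ← exp_zero, exp_lt_exp]; norm_num)
    rwa [hk, ← exp_zero, exp_lt_exp] at this
  -- The element `f * π ^ n` is a unit for `v`, hence for `w`. So `w` takes only values `exp` of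
  -- multiples of `k`, and surjectivity forces `k = -1`.
  have key : ∀ f : F, ∀ n : ℤ, v f = exp n → w f = exp (-(n * k)) := by
    intro f n hn
    have h1 : v (f * π ^ n) = 1 := by
      rw [map_mul, map_zpow₀, hn, hπ, ← exp_zsmul, ← exp_add]
      simp
    have h2 : w (f * π ^ n) = 1 := h.eq_one_iff_eq_one.1 h1
    rw [map_mul, map_zpow₀, hk, ← exp_zsmul] at h2
    rw [eq_inv_of_mul_eq_one_left h2, ← exp_neg]
    simp
  obtain ⟨f, hf⟩ := hw (exp 1)
  have hf0 : f ≠ 0 := by rintro rfl; exact exp_ne_zero (hf.symm.trans (map_zero w))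
  have hk1 : k = -1 := by
    have h1 := key f (log (v f)) (exp_log ((Valuation.ne_zero_iff _).2 hf0)).symm
    rw [hf, exp_inj] at h1
    have h2 : k ∣ 1 := ⟨-(log (v f)), by linarith⟩
    rcases Int.isUnit_iff.1 (isUnit_of_dvd_one h2) with h | h <;> omega
  ext f
  by_cases hf : f = 0
  · simp [hf]
  · have h0 := (exp_log ((Valuation.ne_zero_iff v).2 hf)).symm
    rw [key f _ h0, hk1]
    simpa using h0

/-- If the nonzero terms of a sum have pairwise different values, no cancellation happens. -/
lemma map_le_map_sum_of_injOn {F ι Γ : Type*} [Field F] [LinearOrderedCommGroupWithZero Γ]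
    (v : Valuation F Γ) (s : Finset ι) (f : ι → F)
    (h : ∀ i ∈ s, ∀ j ∈ s, f i ≠ 0 → v (f i) = v (f j) → i = j) :
    ∀ i ∈ s, v (f i) ≤ v (∑ j ∈ s, f j) := by
  classical
  intro i hi
  obtain ⟨k, hk, hmax⟩ := s.exists_max_image (fun j => v (f j)) ⟨i, hi⟩
  by_cases hk0 : f k = 0
  · have := hmax i hi
    simp only [hk0, map_zero, le_zero_iff] at this
    simp [this]
  · have hlt : v (∑ j ∈ s.erase k, f j) < v (f k) := by
      refine v.map_sum_lt ((Valuation.ne_zero_iff _).2 hk0) fun j hj => ?_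
      refine lt_of_le_of_ne (hmax j (Finset.mem_of_mem_erase hj)) fun he => ?_
      exact Finset.ne_of_mem_erase hj (h k hk j (Finset.mem_of_mem_erase hj) hk0 he.symm).symm
    rw [← Finset.add_sum_erase s f hk, v.map_add_eq_of_lt_left hlt]
    exact hmax i hi

/-- Otherwise every nonzero element of `O`, and so every nonzero fraction, would have value `1`,
against surjectivity. This makes the centre of `Q` on `O` a nonzero prime. -/
lemma exists_ne_zero_lt_one {K F O : Type*} [Field K] [Field F] [Algebra K F] [CommRing O]
    [IsDomain O] [Algebra O F] [IsFractionRing O F] (Q : Place K F)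
    (h : ∀ o : O, Q.v (algebraMap O F o) ≤ 1) : ∃ o : O, o ≠ 0 ∧ Q.v (algebraMap O F o) < 1 := by
  by_contra! hc
  obtain ⟨f, hf⟩ := Q.surjective (exp 1)
  obtain ⟨a, b, hb, rfl⟩ := IsFractionRing.div_surjective (A := O) f
  have hb0 : b ≠ 0 := nonZeroDivisors.ne_zero hb
  have ha0 : a ≠ 0 := by
    rintro rfl
    rw [map_zero, zero_div, map_zero] at hf
    exact exp_ne_zero hf.symm
  rw [map_div₀, (h a).antisymm (hc a ha0), (h b).antisymm (hc b hb0)] at hf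
  rw [div_one, ← exp_zero, exp_inj] at hf
  omega

section Dedekind

variable {K F : Type*} [Field K] [Field F] [Algebra K F]
variable {O : Type*} [CommRing O] [IsDedekindDomain O] [Algebra K O] [Algebra O F]
  [IsScalarTower K O F] [IsFractionRing O F]

variable (K F) in
/-- The place attached to a maximal ideal of a Dedekind domain with fraction field `F`. -/
def placeOfPrime (p : HeightOneSpectrum O) : Place K F where
  v := p.valuation F
  surjective := p.valuation_surjective F
  trivial_on_constants := fun c hc => by
    have hu : IsUnit (algebraMap K O c) := (IsUnit.mk0 c hc).map _
    rw [IsScalarTower.algebraMap_apply K O F, p.valuation_eq_one_iff_notMem]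
    exact fun h => p.isPrime.ne_top (Ideal.eq_top_of_isUnit_mem _ h hu)

lemma placeOfPrime_injective :
    Function.Injective (placeOfPrime K F : HeightOneSpectrum O → Place K F) := by
  intro p q h
  refine HeightOneSpectrum.eq_of_valuation_isEquiv_valuation (K := F) ?_
  have : p.valuation F = q.valuation F := congrArg Place.v h
  rw [this]

/-- A place whose valuation ring contains the Dedekind domain `O` comes from a maximal ideal. -/
lemma exists_eq_placeOfPrime (Q : Place K F) (h : ∀ o : O, Q.v (algebraMap O F o) ≤ 1) :
    ∃ p : HeightOneSpectrum O, Q = placeOfPrime K F p := by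
  obtain ⟨o, ho, hoQ⟩ := exists_ne_zero_lt_one Q h
  let I : Ideal O :=
    { carrier := {a | Q.v (algebraMap O F a) < 1}
      add_mem' := fun {a b} ha hb => by
        simp only [Set.mem_ofPred_eq, map_add] at *
        exact Q.v.map_add_lt ha hb
      zero_mem' := by simp
      smul_mem' := fun c a ha => by
        simp only [Set.mem_ofPred_eq, smul_eq_mul, map_mul] at *
        exact (mul_le_of_le_one_left' (h c)).trans_lt ha }
  have hI : ∀ a, a ∈ I ↔ Q.v (algebraMap O F a) < 1 := fun a => Iff.rfl
  have hprime : I.IsPrime := by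
    refine ⟨fun ht => ?_, fun {a b} hab => ?_⟩
    · have : (1 : O) ∈ I := ht ▸ Submodule.mem_top
      simp [hI] at this
    · by_contra! hc
      simp only [hI, not_lt] at hc
      rw [hI, map_mul, map_mul, (h a).antisymm hc.1, (h b).antisymm hc.2] at hab
      simp at hab
  let p : HeightOneSpectrum O := ⟨I, hprime, fun hb => ho (by
    have : o ∈ I := hoQ
    rwa [hb] at this)⟩
  refine ⟨p, ?_⟩
  ext1
  refine (eq_of_isEquiv_of_surjective (p.valuation_surjective F) Q.surjective ?_).symm
  have hd : ∀ d ∈ p.asIdeal.primeCompl, Q.v (algebraMap O F d) = 1 := fun d hd =>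
    (h d).antisymm (not_lt.1 hd)
  -- The localization of `O` at `p` lies in the valuation ring of `Q`. Being a discrete valuation
  -- ring, it has no proper overring except `F`, so the two rings agree.
  have hsub : (p.valuation F).valuationSubring ≤ Q.v.valuationSubring := by
    rw [← HeightOneSpectrum.valuationSubringAtPrime_eq_valuationSubring]
    rintro f ⟨a, s, hs, rfl⟩
    rw [Valuation.mem_valuationSubring_iff, map_mul, map_inv₀, hd s hs, inv_one, mul_one]
    exact h a
  rw [Valuation.isEquiv_iff_valuationSubring]
  refine ValuationSubring.eq_of_le_of_ne_top _ hsub ?_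
  intro ht
  obtain ⟨f, hf⟩ := Q.surjective (exp 1)
  have : f ∈ Q.v.valuationSubring := ht ▸ trivial
  rw [Valuation.mem_valuationSubring_iff, hf, ← exp_zero, exp_le_exp] at this
  omega

/-- The residue map from `O` to the residue class field of a place above `O` is onto. -/
lemma exists_surjective_residue (p : HeightOneSpectrum O) :
    ∃ φ : (O ⧸ p.asIdeal) →ₗ[K] ((placeOfPrime K F p).valuationRing ⧸
      (placeOfPrime K F p).maximalIdeal), Function.Surjective φ := by
  set Q := placeOfPrime K F p with hQ
  have hle : ∀ a : O, Q.v (algebraMap O F a) ≤ 1 := fun a => p.valuation_le_one a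
  have hlt : ∀ a : O, Q.v (algebraMap O F a) < 1 ↔ a ∈ p.asIdeal :=
    fun a => p.valuation_lt_one_iff_mem a
  let ψ : O →ₐ[K] Q.valuationRing :=
    (IsScalarTower.toAlgHom K O F).codRestrict Q.valuationRing hle
  let φ : (O ⧸ p.asIdeal) →ₐ[K] (Q.valuationRing ⧸ Q.maximalIdeal) :=
    Ideal.quotientMapₐ Q.maximalIdeal ψ fun a ha => (hlt a).2 ha
  refine ⟨φ.toLinearMap, fun z => ?_⟩
  obtain ⟨f, rfl⟩ := Ideal.Quotient.mk_surjective z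
  have hf : (f : F) ∈ (p.valuation F).valuationSubring := f.2
  rw [← HeightOneSpectrum.valuationSubringAtPrime_eq_valuationSubring] at hf
  obtain ⟨a, s, hs, hfs⟩ := hf
  have hmax : p.asIdeal.IsMaximal := p.isMaximal
  obtain ⟨c, i, hi, hci⟩ := hmax.exists_inv hs
  refine ⟨Ideal.Quotient.mk _ (a * c), ?_⟩
  change φ (Ideal.Quotient.mk _ (a * c)) = _
  refine (Ideal.quotient_map_mkₐ _ _ _).trans ?_
  refine Ideal.Quotient.eq.2 ?_
  change Q.v _ < 1
  have hs0 : algebraMap O F s ≠ 0 := by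
    intro h0
    apply hs
    have : s = 0 := by simpa using h0
    rw [this]
    exact zero_mem _
  have : ((ψ (a * c) - f : Q.valuationRing) : F)
      = - (algebraMap O F a * algebraMap O F i) / algebraMap O F s := by
    change algebraMap O F (a * c) - (f : F) = _
    rw [hfs]
    have h1 := congrArg (algebraMap O F) hci
    simp only [map_add, map_mul, map_one] at h1
    rw [map_mul]
    field_simp
    linear_combination (algebraMap O F a) * h1
  have hs1 : Q.v (algebraMap O F s) = 1 := p.valuation_eq_one_iff_notMem.2 hs
  rw [this, map_div₀, hs1, div_one, Valuation.map_neg, map_mul]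
  exact (mul_le_of_le_one_left' (hle a)).trans_lt ((hlt i).2 hi)

/-- The places above `O` at which a given nonzero element of `O` vanishes contribute at most the
dimension of the quotient. -/
lemma sum_mul_degree_le [Finite K] {z : O} [Module.Finite K (O ⧸ Ideal.span {z})]
    (S : Finset (HeightOneSpectrum O)) (e : HeightOneSpectrum O → ℕ)
    (he : ∀ p ∈ S, p.valuation F (algebraMap O F z) ≤ exp (-(e p : ℤ))) (he0 : ∀ p ∈ S, 0 < e p) :
    (∀ p ∈ S, Module.Finite K ((placeOfPrime K F p).valuationRing ⧸
      (placeOfPrime K F p).maximalIdeal)) ∧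
    ∑ p ∈ S, e p * (placeOfPrime K F p).degree
      ≤ Module.finrank K (O ⧸ Ideal.span {z}) := by
  classical
  have hmem : ∀ p ∈ S, z ∈ p.asIdeal ^ e p := fun p hp => by
    rw [← HeightOneSpectrum.intValuation_le_pow_iff_mem,
      ← HeightOneSpectrum.valuation_of_algebraMap (K := F)]
    exact he p hp
  have hfin : ∀ p ∈ S, Module.Finite K (O ⧸ p.asIdeal) := fun p hp => by
    have hle : Ideal.span {z} ≤ p.asIdeal := by
      rw [Ideal.span_singleton_le_iff_mem]
      exact Ideal.pow_le_self (he0 p hp).ne' (hmem p hp)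
    exact Module.Finite.of_surjective (Ideal.Quotient.factorₐ K hle).toLinearMap
      (Ideal.Quotient.factor_surjective hle)
  have hdeg : ∀ p ∈ S, Module.Finite K ((placeOfPrime K F p).valuationRing ⧸
      (placeOfPrime K F p).maximalIdeal) ∧
      (placeOfPrime K F p).degree ≤ Module.finrank K (O ⧸ p.asIdeal) := fun p hp => by
    have := hfin p hp
    obtain ⟨φ, hφ⟩ := exists_surjective_residue (K := K) (F := F) p
    exact ⟨Module.Finite.of_surjective φ hφ, LinearMap.finrank_le_finrank_of_surjective hφ⟩
  refine ⟨fun p hp => (hdeg p hp).1, ?_⟩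
  -- Since `K` is finite, dimensions can be compared by counting elements, and cardinalities of
  -- quotients are multiplicative over coprime ideals and prime powers.
  have hcard : ∀ T ⊆ S, Submodule.cardQuot (∏ p ∈ T, p.asIdeal ^ e p)
      = ∏ p ∈ T, Submodule.cardQuot p.asIdeal ^ e p := by
    intro T
    induction T using Finset.induction_on with
    | empty => intro _; simp
    | insert p T hp ih =>
      intro hT
      rw [Finset.prod_insert hp, Finset.prod_insert hp, cardQuot_mul_of_coprime,
        cardQuot_pow_of_prime p.ne_bot, ih fun x hx => hT (Finset.mem_insert_of_mem hx)]
      refine IsCoprime.prod_right fun q hq => IsCoprime.pow ?_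
      have hpq : p ≠ q := fun h => hp (h ▸ hq)
      rw [Ideal.isCoprime_iff_sup_eq]
      exact p.isMaximal.coprime_of_ne q.isMaximal fun h => hpq (HeightOneSpectrum.ext h)
  have hle : Ideal.span {z} ≤ ∏ p ∈ S, p.asIdeal ^ e p := by
    rw [Ideal.span_singleton_le_iff_mem, ← Ideal.dvd_span_singleton]
    refine Finset.prod_dvd_of_coprime (fun p hp q hq hpq => IsCoprime.pow ?_) fun p hp => ?_
    · rw [Ideal.isCoprime_iff_sup_eq]
      exact p.isMaximal.coprime_of_ne q.isMaximal fun h => hpq (HeightOneSpectrum.ext h)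
    · rw [Ideal.dvd_span_singleton]
      exact hmem p hp
  have hfz : Finite (O ⧸ Ideal.span {z}) := Module.finite_of_finite K
  have h1 : Nat.card (O ⧸ ∏ p ∈ S, p.asIdeal ^ e p) ≤ Nat.card (O ⧸ Ideal.span {z}) :=
    Nat.card_le_card_of_surjective _ (Ideal.Quotient.factor_surjective hle)
  have h2 : ∏ p ∈ S, Submodule.cardQuot p.asIdeal ^ e p
      = Nat.card K ^ ∑ p ∈ S, e p * Module.finrank K (O ⧸ p.asIdeal) := by
    rw [← Finset.prod_pow_eq_pow_sum]
    refine Finset.prod_congr rfl fun p hp => ?_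
    have := hfin p hp
    rw [Submodule.cardQuot_apply, Module.natCard_eq_pow_finrank (K := K), ← pow_mul, mul_comm]
  rw [← Submodule.cardQuot_apply, hcard S subset_rfl, h2,
    Module.natCard_eq_pow_finrank (K := K) (V := O ⧸ Ideal.span {z})] at h1
  have h3 := (Nat.pow_le_pow_iff_right (Finite.one_lt_card (α := K))).1 h1
  exact (Finset.sum_le_sum fun p hp => Nat.mul_le_mul_left _ (hdeg p hp).2).trans h3

end Dedekind

end KummerDivisor

end

/-! ### Riemann–Roch spaces under enlargement of the divisor -/

noncomputable section

namespace KummerDivisor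

open WithZero IsDedekindDomain

section RiemannRochSpace

variable {K F : Type*} [Field K] [Field F] [Algebra K F]

/-- The residue class field of a place. -/
abbrev Place.residueField (P : Place K F) : Type _ := P.valuationRing ⧸ P.maximalIdeal

lemma riemannRochSpace_mono {A B : Divisor K F} (h : A ≤ B) :
    riemannRochSpace A ≤ riemannRochSpace B :=
  fun _ hf P => (hf P).trans (exp_le_exp.2 (h P))

lemma Divisor.degree_add (A B : Divisor K F) : (A + B).degree = A.degree + B.degree := by
  unfold Divisor.degree
  exact Finsupp.sum_add_index' (by simp) (by intros; ring)

lemma Divisor.degree_single (P : Place K F) (n : ℤ) :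
    Divisor.degree (Finsupp.single P n) = n * P.degree := by
  unfold Divisor.degree
  exact Finsupp.sum_single_index (by simp)

lemma Divisor.degree_zero : Divisor.degree (0 : Divisor K F) = 0 := by
  simp [Divisor.degree]

lemma Divisor.degree_sum {ι : Type*} (s : Finset ι) (A : ι → Divisor K F) :
    (∑ i ∈ s, A i).degree = ∑ i ∈ s, (A i).degree := by
  classical
  induction s using Finset.induction_on with
  | empty => simp [Divisor.degree_zero]
  | insert i s hi ih => rw [Finset.sum_insert hi, Finset.sum_insert hi, degree_add, ih]

/-- Adding one place raises the dimension by at most the degree of the place. -/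
lemma ell_add_single_le (A : Divisor K F) (Q : Place K F) [Module.Finite K Q.residueField]
    [Module.Finite K (riemannRochSpace (A + Finsupp.single Q 1))] :
    ell (A + Finsupp.single Q 1) ≤ ell A + Q.degree := by
  classical
  -- Multiplication by an element of order `A Q + 1` makes every `f ∈ ℒ(A + Q)` regular at `Q`; its
  -- residue vanishes exactly when `f ∈ ℒ(A)`.
  obtain ⟨π, hπ⟩ := Q.surjective (exp (-(A Q + 1)))
  have hmul : ∀ f : riemannRochSpace (A + Finsupp.single Q 1),
      (f : F) * π ∈ Q.valuationRing := fun f => by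
    have h := f.2 Q
    change Q.v _ ≤ 1
    rw [map_mul, hπ]
    refine (mul_le_mul_left h _).trans ?_
    rw [← exp_add]
    simp
  let φ : riemannRochSpace (A + Finsupp.single Q 1) →ₗ[K] Q.residueField :=
    { toFun := fun f => Ideal.Quotient.mk _ ⟨f * π, hmul f⟩
      map_add' := fun f g => by
        rw [← map_add]
        congr 1
        ext
        simp [add_mul]
      map_smul' := fun c f => by
        rw [RingHom.id_apply, ← Ideal.Quotient.mkₐ_eq_mk K, ← map_smul]
        congr 1
        ext
        simp }
  have hker : ∀ f ∈ LinearMap.ker φ, (f : F) ∈ riemannRochSpace A := by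
    intro f hf P
    by_cases hP : P = Q
    · subst hP
      have h1 : P.v ((f : F) * π) < 1 := Ideal.Quotient.eq_zero_iff_mem.1 (LinearMap.mem_ker.1 hf)
      by_cases h0 : P.v (f : F) = 0
      · rw [h0]
        exact zero_le
      · rw [map_mul, hπ, ← exp_log h0, ← exp_add, ← exp_zero, exp_lt_exp] at h1
        rw [← exp_log h0, exp_le_exp]
        omega
    · have := f.2 P
      rwa [Finsupp.add_apply, Finsupp.single_eq_of_ne hP, add_zero] at this
  have hle : riemannRochSpace A ≤ riemannRochSpace (A + Finsupp.single Q 1) :=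
    riemannRochSpace_mono (by simp)
  have hfin : Module.Finite K (riemannRochSpace A) :=
    Module.Finite.of_injective (Submodule.inclusion hle) (Submodule.inclusion_injective hle)
  have h1 : Module.finrank K (LinearMap.ker φ) ≤ ell A :=
    LinearMap.finrank_le_finrank_of_injective
      (f := ((Submodule.subtype _).comp (Submodule.subtype _)).codRestrict (riemannRochSpace A)
        fun f : LinearMap.ker φ => hker f.1 f.2)
      fun f g h => by
        rw [Subtype.ext_iff] at h
        exact Subtype.ext (Subtype.ext h)
  have h2 := φ.finrank_range_add_finrank_ker
  have h3 : Module.finrank K (LinearMap.range φ) ≤ Q.degree := Submodule.finrank_le _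
  change Module.finrank K _ ≤ _
  omega

/-- `deg A - ℓ(A)` is monotone in `A`. -/
lemma degree_sub_ell_mono (hres : ∀ Q : Place K F, Module.Finite K Q.residueField)
    {A B : Divisor K F} (h : A ≤ B) [hB : Module.Finite K (riemannRochSpace B)] :
    A.degree - (ell A : ℤ) ≤ B.degree - (ell B : ℤ) := by
  classical
  -- `B - A` is effective, so `B` is reached by adding one place at a time. Each intermediate space
  -- lies in `ℒ(B)` and is finite-dimensional, so `finrank` never takes its default value `0`.
  have key : ∀ D : Place K F →₀ ℕ, ∀ A : Divisor K F,
      Module.Finite K (riemannRochSpace (A + D.mapRange Nat.cast Nat.cast_zero)) →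
      A.degree - (ell A : ℤ) ≤ (A + D.mapRange Nat.cast Nat.cast_zero).degree
        - (ell (A + D.mapRange Nat.cast Nat.cast_zero) : ℤ) := by
    intro D
    induction D using Finsupp.induction_linear with
    | zero => intro A _; simp
    | add D E hD hE =>
      intro A hA
      rw [Finsupp.mapRange_add (fun a b => Nat.cast_add a b), ← add_assoc] at hA ⊢
      refine (hD A ?_).trans (hE _ hA)
      have hle : riemannRochSpace (A + D.mapRange ((↑) : ℕ → ℤ) Nat.cast_zero) ≤ riemannRochSpace
          (A + D.mapRange ((↑) : ℕ → ℤ) Nat.cast_zero + E.mapRange ((↑) : ℕ → ℤ) Nat.cast_zero) :=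
        riemannRochSpace_mono (le_add_of_nonneg_right fun P => by simp)
      exact Module.Finite.of_injective (Submodule.inclusion hle) (Submodule.inclusion_injective hle)
    | single Q n =>
      induction n with
      | zero => intro A _; simp
      | succ n ih =>
        intro A hA
        have hs : (Finsupp.single Q (n + 1)).mapRange ((↑) : ℕ → ℤ) Nat.cast_zero
            = (Finsupp.single Q n).mapRange ((↑) : ℕ → ℤ) Nat.cast_zero + Finsupp.single Q 1 := by
          rw [Finsupp.mapRange_single, Finsupp.mapRange_single, ← Finsupp.single_add]
          norm_cast
        rw [hs, ← add_assoc] at hA ⊢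
        have hle : riemannRochSpace (A + (Finsupp.single Q n).mapRange ((↑) : ℕ → ℤ) Nat.cast_zero)
            ≤ riemannRochSpace (A + (Finsupp.single Q n).mapRange ((↑) : ℕ → ℤ) Nat.cast_zero
              + Finsupp.single Q 1) :=
          riemannRochSpace_mono (by simp)
        refine (ih A (Module.Finite.of_injective (Submodule.inclusion hle)
          (Submodule.inclusion_injective hle))).trans ?_
        have := hres Q
        have h1 := ell_add_single_le
          (A + (Finsupp.single Q n).mapRange ((↑) : ℕ → ℤ) Nat.cast_zero) Q
        rw [Divisor.degree_add _ (Finsupp.single Q 1), Divisor.degree_single]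
        push_cast [← Nat.cast_le (α := ℤ)] at h1
        linarith
  have hBA : B = A + ((B - A).mapRange Int.toNat Int.toNat_zero).mapRange Nat.cast
      Nat.cast_zero := by
    ext P
    have := h P
    simp
    omega
  rw [hBA] at hB
  have := key _ A hB
  rwa [← hBA] at this

end RiemannRochSpace

end KummerDivisor

end

/-! ### Places where `t` is regular, through the integral closure of `K[t]` -/

noncomputable section

namespace KummerDivisor

open WithZero IsDedekindDomain Polynomial IntermediateField algebraAdjoinAdjoin

section FinitePlaces

/-- Coefficients may be reduced modulo `w`, so `n` copies of the polynomials of degree below `deg w`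
map onto the quotient. -/
lemma finite_and_finrank_quotient_le_of_span {K O : Type*} [Field K] [CommRing O] [Algebra K O]
    (ψ : K[X] →ₐ[K] O) {n : ℕ} (b : Fin n → O)
    (hb : ∀ o, ∃ u : Fin n → K[X], o = ∑ i, ψ (u i) * b i)
    {w : K[X]} (hw : w ≠ 0) :
    Module.Finite K (O ⧸ Ideal.span {ψ w}) ∧
    Module.finrank K (O ⧸ Ideal.span {ψ w}) ≤ n * w.natDegree := by
  let φ : (Fin n → degreeLT K w.natDegree) →ₗ[K] (O ⧸ Ideal.span {ψ w}) :=
    ∑ i, ((Ideal.Quotient.mkₐ K (Ideal.span {ψ w})).toLinearMap.comp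
      ((LinearMap.mulRight K (b i)).comp ψ.toLinearMap)).comp
        ((Submodule.subtype _).comp (LinearMap.proj i))
  have hφ : ∀ p, φ p = Ideal.Quotient.mk _ (∑ i, ψ (p i : K[X]) * b i) := by
    intro p
    simp only [φ, LinearMap.sum_apply, map_sum]
    rfl
  have hsurj : Function.Surjective φ := by
    intro z
    obtain ⟨o, rfl⟩ := Ideal.Quotient.mk_surjective z
    obtain ⟨u, rfl⟩ := hb o
    refine ⟨fun i => ⟨u i % w, ?_⟩, ?_⟩
    · rw [mem_degreeLT, ← degree_eq_natDegree hw]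
      exact degree_mod_lt _ hw
    · rw [hφ, Ideal.Quotient.eq, Ideal.mem_span_singleton, ← Finset.sum_sub_distrib]
      refine Finset.dvd_sum fun i _ => ?_
      rw [← sub_mul, ← map_sub]
      refine Dvd.dvd.mul_right (_root_.map_dvd ψ ⟨-(u i / w), ?_⟩) _
      linear_combination EuclideanDomain.mod_add_div (u i) w
  have : Module.Finite K (degreeLT K w.natDegree) :=
    Module.Finite.equiv (degreeLTEquiv K w.natDegree).symm
  refine ⟨Module.Finite.of_surjective φ hsurj, ?_⟩
  refine (LinearMap.finrank_le_finrank_of_surjective hsurj).trans ?_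
  rw [Module.finrank_pi_fintype, (degreeLTEquiv K w.natDegree).finrank_eq]
  simp

variable {K F : Type*} [Field K] [Field F] [Algebra K F] (t : F)

/-- The integral closure of `K[t]` in `F`. -/
abbrev integers : Type _ := integralClosure (Algebra.adjoin K {t}) F

/-- `p(t)`, as an element of the integral closure of `K[t]` in `F`. -/
def integersOfPolynomial : K[X] →ₐ[K] integers (K := K) t :=
  (IsScalarTower.toAlgHom K (Algebra.adjoin K {t}) (integers (K := K) t)).comp
    (aeval (⟨t, Algebra.self_mem_adjoin_singleton K t⟩ : Algebra.adjoin K {t}))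

lemma aeval_adjoin_coe (w : K[X]) :
    ((aeval (⟨t, Algebra.self_mem_adjoin_singleton K t⟩ : Algebra.adjoin K {t}) w :
      Algebra.adjoin K {t}) : F) = aeval t w :=
  (aeval_algHom_apply (Algebra.adjoin K {t}).val
    (⟨t, Algebra.self_mem_adjoin_singleton K t⟩ : Algebra.adjoin K {t}) w).symm

lemma exists_aeval_adjoin (a : Algebra.adjoin K {t}) :
    ∃ w : K[X],
      a = aeval (⟨t, Algebra.self_mem_adjoin_singleton K t⟩ : Algebra.adjoin K {t}) w := by
  obtain ⟨w, hw⟩ := (Algebra.adjoin_singleton_eq_range_aeval K t).le a.2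
  exact ⟨w, Subtype.ext (by rw [aeval_adjoin_coe]; exact hw.symm)⟩

lemma algebraMap_integersOfPolynomial (w : K[X]) :
    algebraMap (integers (K := K) t) F (integersOfPolynomial t w) = aeval t w :=
  aeval_adjoin_coe t w

lemma algebraMap_adjoin_integers_injective :
    Function.Injective (algebraMap (Algebra.adjoin K {t}) (integers (K := K) t)) :=
  fun _ _ h => Subtype.ext (congrArg (fun o : integers (K := K) t => (o : F)) h)

variable {t}

lemma isPrincipalIdealRing_adjoin (ht : Transcendental K t) :
    IsPrincipalIdealRing (Algebra.adjoin K {t}) :=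
  IsPrincipalIdealRing.of_surjective
    (Polynomial.algEquivOfTranscendental K t ht).toRingEquiv.toRingHom
    (Polynomial.algEquivOfTranscendental K t ht).surjective

lemma Place.v_aeval_le_one (Q : Place K F) (hQ : Q.v t ≤ 1) (w : K[X]) : Q.v (aeval t w) ≤ 1 := by
  rw [aeval_eq_sum_range]
  refine Q.v.map_sum_le fun i _ => ?_
  rw [Algebra.smul_def, map_mul, map_pow]
  exact mul_le_one' (Q.v_algebraMap_le_one _) (pow_le_one' hQ i)

/-- The valuation ring of `Q` contains `K[t]` and is integrally closed. -/
lemma Place.v_integers_le_one (Q : Place K F) (hQ : Q.v t ≤ 1) (o : integers (K := K) t) :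
    Q.v (algebraMap _ F o) ≤ 1 := by
  have hR : ∀ a : Algebra.adjoin K {t}, (a : F) ∈ Q.v.integer := fun a => by
    obtain ⟨w, rfl⟩ := exists_aeval_adjoin t a
    rw [aeval_adjoin_coe]
    exact Q.v_aeval_le_one hQ w
  let φ : Algebra.adjoin K {t} →+* Q.v.integer :=
    (algebraMap (Algebra.adjoin K {t}) F).codRestrict Q.v.integer hR
  obtain ⟨p, hp, he⟩ := o.2
  refine (Valuation.integer.integers Q.v).mem_of_integral (x := (o : F))
    ⟨p.map φ, hp.map φ, ?_⟩
  rw [eval₂_map]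
  exact he

section

variable [FiniteDimensional K⟮t⟯ F]

instance : IsFractionRing (integers (K := K) t) F :=
  integralClosure.isFractionRing_of_finite_extension K⟮t⟯ F

variable [Algebra.IsSeparable K⟮t⟯ F]

lemma isDedekindDomain_integers (ht : Transcendental K t) :
    IsDedekindDomain (integers (K := K) t) :=
  have := isPrincipalIdealRing_adjoin ht
  integralClosure.isDedekindDomain (Algebra.adjoin K {t}) K⟮t⟯ F

/-- There is a place at which a given transcendental element vanishes. -/
lemma exists_place_v_lt_one (ht : Transcendental K t) : ∃ Q : Place K F, Q.v t < 1 := by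
  have := isDedekindDomain_integers ht
  have := isPrincipalIdealRing_adjoin ht
  let e := Polynomial.algEquivOfTranscendental K t ht
  let P : Ideal (Algebra.adjoin K {t}) := Ideal.span {e X}
  have hpr : Prime (e X) := (MulEquiv.prime_iff e.toMulEquiv).2 prime_X
  have hP : P.IsPrime := (Ideal.span_singleton_prime hpr.ne_zero).2 hpr
  obtain ⟨q, hq, hqP⟩ := Ideal.exists_ideal_over_prime_of_isIntegral_of_isDomain
    (S := integers (K := K) t) P (by
      rw [(RingHom.injective_iff_ker_eq_bot _).1
        (algebraMap_adjoin_integers_injective t)]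
      exact bot_le)
  have hmem : algebraMap _ (integers (K := K) t) (e X) ∈ q := by
    rw [← Ideal.mem_comap, hqP]
    exact Ideal.mem_span_singleton_self _
  have hqb : q ≠ ⊥ := by
    rintro rfl
    have h0 : algebraMap _ (integers (K := K) t) (e X) = 0 := Ideal.mem_bot.1 hmem
    exact hpr.ne_zero (algebraMap_adjoin_integers_injective t (h0.trans (map_zero _).symm))
  refine ⟨placeOfPrime K F (⟨q, hq, hqb⟩ : HeightOneSpectrum (integers (K := K) t)), ?_⟩
  have h := (HeightOneSpectrum.valuation_lt_one_iff_mem (K := F)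
    (⟨q, hq, hqb⟩ : HeightOneSpectrum (integers (K := K) t)) _).2 hmem
  have hX : ((e X : Algebra.adjoin K {t}) : F) = t := by simp [e]
  change HeightOneSpectrum.valuation F _ ((e X : Algebra.adjoin K {t}) : F) < 1 at h
  rwa [hX] at h

/-- Functions without finite poles are integral over `K[t]`. -/
lemma isIntegral_of_forall_v_le_one (ht : Transcendental K t) {f : F}
    (hf : ∀ Q : Place K F, Q.v t ≤ 1 → Q.v f ≤ 1) : IsIntegral (Algebra.adjoin K {t}) f := by
  have := isDedekindDomain_integers ht
  obtain ⟨o, rfl⟩ := HeightOneSpectrum.mem_integers_of_valuation_le_one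
    (R := integers (K := K) t) F f fun p => by
      refine hf (placeOfPrime K F p) ?_
      have h : p.valuation F (algebraMap _ F (integersOfPolynomial t (X : K[X]))) ≤ 1 :=
        p.valuation_le_one _
      rwa [algebraMap_integersOfPolynomial, aeval_X] at h
  exact o.2

/-- By integrality, the maximal ideal belonging to `Q` meets `K[t]` in a nonzero ideal. -/
lemma exists_aeval_lt_one (ht : Transcendental K t) (Q : Place K F) (hQ : Q.v t ≤ 1) :
    ∃ w : K[X], w ≠ 0 ∧ Q.v (aeval t w) < 1 := by
  have := isDedekindDomain_integers ht
  obtain ⟨p, rfl⟩ := exists_eq_placeOfPrime Q (Q.v_integers_le_one hQ)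
  have hb := Ideal.IsIntegral.comap_ne_bot (R := Algebra.adjoin K {t}) p.ne_bot
  obtain ⟨a, ha, ha0⟩ := Submodule.exists_mem_ne_zero_of_ne_bot hb
  obtain ⟨w, rfl⟩ := exists_aeval_adjoin t a
  refine ⟨w, ?_, ?_⟩
  · rintro rfl
    simp at ha0
  · rw [← algebraMap_integersOfPolynomial]
    exact (p.valuation_lt_one_iff_mem _).2 ha

/-- `K[t]` is principal, so by separability its integral closure is free of rank `[F : K(t)]`. This
bounds the degree of the zero divisor of `w(t)`, the only half of the degree formula that is needed.
-/
lemma finite_and_finrank_quotient_le (ht : Transcendental K t) {w : K[X]} (hw : w ≠ 0) :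
    Module.Finite K (integers (K := K) t ⧸ Ideal.span {integersOfPolynomial t w}) ∧
    Module.finrank K (integers (K := K) t ⧸ Ideal.span {integersOfPolynomial t w})
      ≤ Module.finrank K⟮t⟯ F * w.natDegree := by
  have := isPrincipalIdealRing_adjoin ht
  have := IsIntegralClosure.module_free (Algebra.adjoin K {t}) K⟮t⟯ F (integers (K := K) t)
  have := IsIntegralClosure.finite (Algebra.adjoin K {t}) K⟮t⟯ F (integers (K := K) t)
  rw [← IsIntegralClosure.rank (Algebra.adjoin K {t}) K⟮t⟯ F (integers (K := K) t)]
  let b := Module.finBasis (Algebra.adjoin K {t}) (integers (K := K) t)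
  refine finite_and_finrank_quotient_le_of_span (integersOfPolynomial t) b (fun o => ?_) hw
  choose u hu using fun i => exists_aeval_adjoin t (b.repr o i)
  refine ⟨u, ?_⟩
  conv_lhs => rw [← b.sum_repr o]
  refine Finset.sum_congr rfl fun i _ => ?_
  rw [Algebra.smul_def, hu i]
  rfl

/-- The zeros of `w(t)` among the finite places, with multiplicities and degrees. -/
lemma exists_finset_zeros [Finite K] (ht : Transcendental K t) {w : K[X]} (hw : w ≠ 0) :
    ∃ S : Finset (Place K F), (∀ Q, Q ∈ S ↔ Q.v t ≤ 1 ∧ Q.v (aeval t w) < 1) ∧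
      (∀ Q ∈ S, Module.Finite K Q.residueField) ∧
      ∑ Q ∈ S, -log (Q.v (aeval t w)) * Q.degree ≤ Module.finrank K⟮t⟯ F * w.natDegree := by
  classical
  have := isDedekindDomain_integers ht
  obtain ⟨hfin, hrank⟩ := finite_and_finrank_quotient_le ht hw
  have hw0 : aeval t w ≠ 0 := fun h => hw ((transcendental_iff.1 ht) w h)
  have hz : integersOfPolynomial t w ≠ 0 := fun h => hw0 (by
    rw [← algebraMap_integersOfPolynomial, h, map_zero])
  have hz' : Ideal.span {integersOfPolynomial t w} ≠ 0 := by
    simpa [Ideal.zero_eq_bot, Ideal.span_singleton_eq_bot] using hz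
  let T := (Ideal.finite_factors hz').toFinset
  have hT : ∀ p, p ∈ T ↔ (placeOfPrime K F p).v (aeval t w) < 1 := fun p => by
    rw [Set.Finite.mem_toFinset, Set.mem_ofPred_eq, Ideal.dvd_span_singleton,
      ← p.valuation_lt_one_iff_mem (K := F), ← algebraMap_integersOfPolynomial]
    rfl
  have ht1 : ∀ p : HeightOneSpectrum (integers (K := K) t), (placeOfPrime K F p).v t ≤ 1 := by
    intro p
    have h : p.valuation F (algebraMap _ F (integersOfPolynomial t (X : K[X]))) ≤ 1 :=
      p.valuation_le_one _
    rwa [algebraMap_integersOfPolynomial, aeval_X] at h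
  let e : HeightOneSpectrum (integers (K := K) t) → ℕ := fun p =>
    (-log ((placeOfPrime K F p).v (aeval t w))).toNat
  have he : ∀ p ∈ T, (e p : ℤ) = -log ((placeOfPrime K F p).v (aeval t w)) ∧ 0 < e p := by
    intro p hp
    have h1 := (hT p).1 hp
    have h0 := (Valuation.ne_zero_iff (placeOfPrime K F p).v).2 hw0
    rw [← exp_log h0, ← exp_zero, exp_lt_exp] at h1
    simp only [e]
    omega
  obtain ⟨h1, h2⟩ := sum_mul_degree_le (K := K) (F := F) (z := integersOfPolynomial t w) T e
    (fun p hp => by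
      rw [algebraMap_integersOfPolynomial, (he p hp).1, neg_neg, exp_log]
      · rfl
      · exact (Valuation.ne_zero_iff (placeOfPrime K F p).v).2 hw0)
    (fun p hp => (he p hp).2)
  refine ⟨T.image (placeOfPrime K F), fun Q => ?_, fun Q hQ => ?_, ?_⟩
  · rw [Finset.mem_image]
    constructor
    · rintro ⟨p, hp, rfl⟩
      exact ⟨ht1 p, (hT p).1 hp⟩
    · rintro ⟨hQ1, hQ2⟩
      obtain ⟨p, rfl⟩ := exists_eq_placeOfPrime Q (Q.v_integers_le_one hQ1)
      exact ⟨p, (hT p).2 hQ2, rfl⟩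
  · obtain ⟨p, hp, rfl⟩ := Finset.mem_image.1 hQ
    exact h1 p hp
  · rw [Finset.sum_image fun p _ q _ h => placeOfPrime_injective h]
    have h3 : ((∑ p ∈ T, e p * (placeOfPrime K F p).degree : ℕ) : ℤ)
        ≤ ((Module.finrank K⟮t⟯ F * w.natDegree : ℕ) : ℤ) := by exact_mod_cast h2.trans hrank
    push_cast at h3
    refine le_trans (le_of_eq (Finset.sum_congr rfl fun p hp => ?_)) h3
    rw [(he p hp).1]

lemma finite_residueField_of_v_le_one [Finite K] (ht : Transcendental K t) (Q : Place K F)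
    (hQ : Q.v t ≤ 1) : Module.Finite K Q.residueField := by
  obtain ⟨w, hw, hwQ⟩ := exists_aeval_lt_one ht Q hQ
  obtain ⟨S, hS, hfin, -⟩ := exists_finset_zeros ht hw
  exact hfin Q ((hS Q).2 ⟨hQ, hwQ⟩)

end

end FinitePlaces

end KummerDivisor

end

/-! ### Totally ramified places -/

noncomputable section

namespace KummerDivisor

open WithZero IsDedekindDomain Polynomial IntermediateField

section TotallyRamified

variable {K F : Type*} [Field K] [Field F] [Algebra K F]

lemma Place.v_eq_one_of_sub_lt_one (Q : Place K F) {u : F} {c : K} (hc : c ≠ 0)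
    (h : Q.v (u - algebraMap K F c) < 1) : Q.v u = 1 := by
  have h1 := Q.trivial_on_constants c hc
  have : u = algebraMap K F c + (u - algebraMap K F c) := by ring
  rw [this, Q.v.map_add_eq_of_lt_left (by rwa [h1]), h1]

/-- The power of `t` is split off, and `c` is the constant term of what remains. The data `n`, `c`,
`u` serve all zeros of `t` at once, which permits comparing two places. -/
lemma exists_eq_pow_mul_of_polynomial (t : F) {w : K[X]} (hw : w ≠ 0) :
    ∃ n : ℕ, ∃ c : K, c ≠ 0 ∧ ∃ u : F, aeval t w = t ^ n * u ∧
      ∀ Q : Place K F, Q.v t < 1 → Q.v (u - algebraMap K F c) < 1 := by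
  obtain ⟨q, hq, hnd⟩ := exists_eq_pow_rootMultiplicity_mul_and_not_dvd w hw 0
  rw [C_0, sub_zero] at hq hnd
  refine ⟨rootMultiplicity 0 w, q.coeff 0, fun h => hnd (X_dvd_iff.2 h), aeval t q, ?_, ?_⟩
  · conv_lhs => rw [hq]
    simp
  · intro Q hQ
    have h1 : aeval t q - algebraMap K F (q.coeff 0) = aeval t q.divX * t := by
      conv_lhs => rw [← divX_mul_X_add q]
      simp
    rw [h1, map_mul]
    exact (mul_le_of_le_one_left' (Q.v_aeval_le_one hQ.le _)).trans_lt hQ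

/-- The leading term at `t = 0` of a rational function in `t`. -/
lemma exists_eq_zpow_mul {t g : F} (hg : g ∈ K⟮t⟯) (hg0 : g ≠ 0) :
    ∃ n : ℤ, ∃ c : K, c ≠ 0 ∧ ∃ u : F, g = t ^ n * u ∧
      ∀ Q : Place K F, Q.v t < 1 → Q.v (u - algebraMap K F c) < 1 := by
  obtain ⟨a, b, rfl⟩ := (mem_adjoin_simple_iff K g).1 hg
  have ha : a ≠ 0 := by rintro rfl; simp at hg0
  have hb : b ≠ 0 := by rintro rfl; simp at hg0
  obtain ⟨n, c, hc, u, hau, hu⟩ := exists_eq_pow_mul_of_polynomial t ha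
  obtain ⟨k, d, hd, w, hbw, hw⟩ := exists_eq_pow_mul_of_polynomial t hb
  have hw0 : w ≠ 0 := by
    rintro rfl
    simp [hbw] at hg0
  have key : ∀ Q : Place K F, Q.v t < 1 → Q.v (u / w - algebraMap K F (c / d)) < 1 := by
    intro Q hQ
    have h1 := Q.v_eq_one_of_sub_lt_one hd (hw Q hQ)
    have hd0 : algebraMap K F d ≠ 0 := by simpa using hd
    have : u / w - algebraMap K F (c / d) = ((u - algebraMap K F c) * algebraMap K F d
        - (w - algebraMap K F d) * algebraMap K F c) / (w * algebraMap K F d) := by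
      rw [map_div₀]; field_simp; ring
    rw [this, map_div₀, map_mul, h1, Q.trivial_on_constants d hd, one_mul, div_one]
    refine Q.v.map_sub_lt ?_ ?_ <;> rw [map_mul, Q.trivial_on_constants _ ‹_›, mul_one]
    exacts [hu Q hQ, hw Q hQ]
  -- For `t = 0` the rule `t ^ (n - k) = t ^ n / t ^ k` fails, but then a nonzero `g` forces both
  -- exponents to be `0`.
  by_cases ht0 : t = 0
  · subst ht0
    have hn : n = 0 := by
      by_contra hn
      simp [hau, hn] at hg0
    have hk : k = 0 := by
      by_contra hn
      simp [hbw, hn] at hg0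
    subst hn hk
    exact ⟨0, c / d, div_ne_zero hc hd, u / w, by simp [hau, hbw], key⟩
  · refine ⟨n - k, c / d, div_ne_zero hc hd, u / w, ?_, key⟩
    rw [hau, hbw, zpow_sub₀ ht0, zpow_natCast, zpow_natCast]
    field_simp

/-- The expansion of every element of `F` in powers of `x` with coefficients in `K(t)`. -/
def SpannedByPowers (K : Type*) {F : Type*} [Field K] [Field F] [Algebra K F] (t x : F) (m : ℕ) :
    Prop :=
  ∀ f : F, ∃ g : Fin m → F, (∀ k, g k ∈ K⟮t⟯) ∧ f = ∑ k, g k * x ^ (k : ℕ)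

variable {t x : F} {m : ℕ} {s : ℤ}

/-- At a place with `v(x)^m = v(t)^s < 1`, where `s` is prime to `m`, the order of a term `g x^k`
determines `k` modulo `m`. -/
lemma Place.exists_log_eq (hm : 0 < m) (hs : IsCoprime (m : ℤ) s) (hx : x ≠ 0) (Q : Place K F)
    (ht : Q.v t < 1) (ht0 : t ≠ 0) (hxt : Q.v x ^ m = Q.v t ^ s) :
    ∃ d : ℤ, 0 < d ∧ Q.v t = exp (-(d * m)) ∧ Q.v x = exp (-(d * s)) := by
  have hvt := (Valuation.ne_zero_iff Q.v).2 ht0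
  have hvx := (Valuation.ne_zero_iff Q.v).2 hx
  obtain ⟨e, he⟩ : ∃ e : ℤ, Q.v t = exp e := ⟨_, (exp_log hvt).symm⟩
  obtain ⟨c, hc⟩ : ∃ c : ℤ, Q.v x = exp c := ⟨_, (exp_log hvx).symm⟩
  have he0 : e < 0 := by rwa [he, ← exp_zero, exp_lt_exp] at ht
  have h1 : m * c = s * e := by
    rw [he, hc, ← exp_zsmul, ← exp_nsmul, exp_inj] at hxt
    simpa using hxt
  obtain ⟨d, hd⟩ : (m : ℤ) ∣ e := hs.dvd_of_dvd_mul_left ⟨c, h1.symm⟩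
  have hm' : (0 : ℤ) < m := by exact_mod_cast hm
  refine ⟨-d, ?_, ?_, ?_⟩
  · nlinarith
  · rw [he, hd]
    congr 1
    ring
  · rw [hc]
    congr 1
    have : (m : ℤ) * c = m * (s * d) := by rw [h1, hd]; ring
    have := mul_left_cancel₀ hm'.ne' this
    linarith

lemma Place.v_term (Q : Place K F) (ht : Q.v t < 1) {d : ℤ} (h1 : Q.v t = exp (-(d * m)))
    (h2 : Q.v x = exp (-(d * s))) {g : F} (hg : g ∈ K⟮t⟯) (hg0 : g ≠ 0) (k : ℕ) :
    ∃ n : ℤ, Q.v (g * x ^ k) = exp (-(d * (m * n + s * k))) := by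
  obtain ⟨n, c, hc, u, rfl, hu⟩ := exists_eq_zpow_mul hg hg0
  refine ⟨n, ?_⟩
  rw [map_mul, map_mul, map_zpow₀, map_pow, h1, h2, Q.v_eq_one_of_sub_lt_one hc (hu Q ht), mul_one,
    ← exp_zsmul, ← exp_nsmul, ← exp_add]
  congr 1
  simp only [smul_eq_mul, nsmul_eq_mul]
  ring

/-- A place with `v(x)^m = v(t)^s < 1`, where `s` is prime to `m`. -/
structure Place.IsRamified (Q : Place K F) (t x : F) (m : ℕ) (s : ℤ) : Prop where
  pos : 0 < m
  coprime : IsCoprime (m : ℤ) s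
  ne_zero : x ≠ 0
  t_ne_zero : t ≠ 0
  lt_one : Q.v t < 1
  pow_eq : Q.v x ^ m = Q.v t ^ s

namespace Place.IsRamified

variable {Q : Place K F}

/-- A nonzero term has order `d(mn + sk)`. Equal orders at `i` and `j` give `m ∣ s(i - j)`, hence `i
= j` as `s` is prime to `m` and `|i - j| < m`. So no cancellation can occur. -/
lemma v_term_le (h : Q.IsRamified t x m s) {g : Fin m → F} (hg : ∀ k, g k ∈ K⟮t⟯)
    (k : Fin m) : Q.v (g k * x ^ (k : ℕ)) ≤ Q.v (∑ j, g j * x ^ (j : ℕ)) := by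
  obtain ⟨d, hd, h1, h2⟩ := Q.exists_log_eq h.pos h.coprime h.ne_zero h.lt_one h.t_ne_zero h.pow_eq
  refine map_le_map_sum_of_injOn Q.v Finset.univ (fun j : Fin m => g j * x ^ (j : ℕ))
    (fun i _ j _ hi0 hij => ?_) k (Finset.mem_univ k)
  have hj0 : g j * x ^ (j : ℕ) ≠ 0 := by
    rw [← Valuation.ne_zero_iff Q.v, ← hij, Valuation.ne_zero_iff]
    exact hi0
  obtain ⟨n, hn⟩ := Q.v_term h.lt_one h1 h2 (hg i) (left_ne_zero_of_mul hi0) i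
  obtain ⟨n', hn'⟩ := Q.v_term h.lt_one h1 h2 (hg j) (left_ne_zero_of_mul hj0) j
  rw [hn, hn', exp_inj, neg_inj] at hij
  have h3 := mul_left_cancel₀ hd.ne' hij
  have h4 : (m : ℤ) ∣ ((i : ℕ) : ℤ) - (j : ℕ) := by
    refine h.coprime.dvd_of_dvd_mul_left ⟨n' - n, ?_⟩
    linarith
  have hi := i.2
  have hj := j.2
  have h5 := Int.eq_zero_of_abs_lt_dvd h4 (by rw [abs_lt]; omega)
  exact Fin.ext (by omega)

lemma v_eq (h : Q.IsRamified t x m s) (hspan : SpannedByPowers K t x m) :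
    Q.v t = exp (-(m : ℤ)) ∧ Q.v x = exp (-s) := by
  obtain ⟨d, hd, h1, h2⟩ := Q.exists_log_eq h.pos h.coprime h.ne_zero h.lt_one h.t_ne_zero h.pow_eq
  -- The order of every function is that of one of its terms, hence a multiple of `d`; but some
  -- function has order `-1`.
  suffices d = 1 by
    subst this
    simpa using And.intro h1 h2
  obtain ⟨f, hf⟩ := Q.surjective (exp 1)
  obtain ⟨g, hg, hfg⟩ := hspan f
  obtain ⟨k, -, hmax⟩ := Finset.univ.exists_max_image
    (fun k : Fin m => Q.v (g k * x ^ (k : ℕ))) ⟨⟨0, h.pos⟩, Finset.mem_univ _⟩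
  have h3 : Q.v (g k * x ^ (k : ℕ)) = exp 1 := by
    rw [← hf]
    refine le_antisymm (hfg ▸ h.v_term_le hg k) ?_
    conv_lhs => rw [hfg]
    exact Q.v.map_sum_le hmax
  have h0 : g k ≠ 0 := by
    rintro h0
    rw [h0, zero_mul, map_zero] at h3
    exact exp_ne_zero h3.symm
  obtain ⟨n, hn⟩ := Q.v_term h.lt_one h1 h2 (hg k) h0 k
  rw [hn, exp_inj] at h3
  have h4 : d ∣ 1 := ⟨-(m * n + s * k), by linarith⟩
  rcases Int.isUnit_iff.1 (isUnit_of_dvd_one h4) with h | h <;> omega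

lemma exists_v_term_eq (h : Q.IsRamified t x m s) (hspan : SpannedByPowers K t x m) {g : F}
    (hg : g ∈ K⟮t⟯) (hg0 : g ≠ 0) (k : ℕ) : ∃ n : ℤ, Q.v (g * x ^ k) = exp (-(m * n + s * k)) := by
  obtain ⟨h1, h2⟩ := h.v_eq hspan
  obtain ⟨n, hn⟩ := Q.v_term (d := 1) (s := s) h.lt_one (by simpa using h1) (by simpa using h2)
    hg hg0 k
  exact ⟨n, by simpa using hn⟩

/-- There is only one such place. -/
lemma unique {Q' : Place K F} (h : Q.IsRamified t x m s) (h' : Q'.IsRamified t x m s)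
    (hspan : SpannedByPowers K t x m) : Q = Q' := by
  have key : ∀ {P P' : Place K F}, P.IsRamified t x m s → P'.IsRamified t x m s →
      ∀ f, P.v f ≤ P'.v f := by
    intro P P' hP hP' f
    obtain ⟨g, hg, hfg⟩ := hspan f
    conv_lhs => rw [hfg]
    refine P.v.map_sum_le fun k _ => ?_
    -- The order of a term depends only on `m`, `s`, `k` and the exponent of `t` in `g k`, which is
    -- the same for both places.
    have h1 : P.v (g k * x ^ (k : ℕ)) = P'.v (g k * x ^ (k : ℕ)) := by
      by_cases hg0 : g k = 0
      · simp [hg0]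
      · obtain ⟨n, c, hc, u, hu, hu'⟩ := exists_eq_zpow_mul (hg k) hg0
        rw [hu]
        simp only [map_mul, map_zpow₀, map_pow, (hP.v_eq hspan).1, (hP.v_eq hspan).2,
          (hP'.v_eq hspan).1, (hP'.v_eq hspan).2,
          P.v_eq_one_of_sub_lt_one hc (hu' P hP.lt_one),
          P'.v_eq_one_of_sub_lt_one hc (hu' P' hP'.lt_one)]
    rw [h1, hfg]
    exact hP'.v_term_le hg k
  ext f
  exact (key h h' f).antisymm (key h' h f)

/-- All terms of `f` are regular, and those with `k > 0` have order nonzero modulo `m`, hence vanish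
at `Q`. The residue is that of the `k = 0` term, a rational function of `t`, and so lies in `K`. -/
lemma exists_sub_lt_one (h : Q.IsRamified t x m s) (hspan : SpannedByPowers K t x m) {f : F}
    (hf : Q.v f ≤ 1) : ∃ c : K, Q.v (f - algebraMap K F c) < 1 := by
  obtain ⟨g, hg, hfg⟩ := hspan f
  have hterm : ∀ k, Q.v (g k * x ^ (k : ℕ)) ≤ 1 := fun k =>
    (h.v_term_le hg k).trans (hfg ▸ hf)
  let z : Fin m := ⟨0, h.pos⟩
  have hzero : ∃ c : K, Q.v (g z - algebraMap K F c) < 1 := by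
    by_cases h0 : g z = 0
    · exact ⟨0, by simp [h0]⟩
    · obtain ⟨n, c, hc, u, hgu, hu⟩ := exists_eq_zpow_mul (hg z) h0
      have hu1 := Q.v_eq_one_of_sub_lt_one hc (hu Q h.lt_one)
      have h1 := hterm z
      have hm := h.pos
      rw [show (z : ℕ) = 0 from rfl, pow_zero, mul_one, hgu, map_mul, hu1, mul_one, map_zpow₀, (h.v_eq hspan).1, ← exp_zsmul,
        ← exp_zero, exp_le_exp, smul_eq_mul] at h1
      rcases eq_or_ne n 0 with rfl | hn
      · exact ⟨c, by simpa [hgu] using hu Q h.lt_one⟩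
      · refine ⟨0, ?_⟩
        rw [map_zero, sub_zero, hgu, map_mul, hu1, mul_one, map_zpow₀, (h.v_eq hspan).1,
          ← exp_zsmul, ← exp_zero, exp_lt_exp, smul_eq_mul]
        refine lt_of_le_of_ne h1 (mul_ne_zero hn ?_)
        omega
  obtain ⟨c, hc⟩ := hzero
  refine ⟨c, ?_⟩
  have hfc : f - algebraMap K F c = (g z - algebraMap K F c)
      + ∑ k ∈ Finset.univ.erase z, g k * x ^ (k : ℕ) := by
    rw [hfg, ← Finset.add_sum_erase _ _ (Finset.mem_univ z)]
    simp only [z, pow_zero, mul_one]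
    ring
  rw [hfc]
  refine Q.v.map_add_lt hc (Q.v.map_sum_lt one_ne_zero fun k hk => ?_)
  have hkz : (k : ℕ) ≠ 0 := fun h0 => Finset.ne_of_mem_erase hk (Fin.ext h0)
  have hkm := k.2
  refine lt_of_le_of_ne (hterm k) fun h1 => ?_
  have h0 : g k ≠ 0 := by
    intro h0
    simp [h0] at h1
  obtain ⟨a, ha⟩ := h.exists_v_term_eq hspan (hg k) h0 k
  rw [ha, ← exp_zero, exp_inj] at h1
  have h4 : (m : ℤ) ∣ ((k : ℕ) : ℤ) :=
    h.coprime.dvd_of_dvd_mul_left ⟨-a, by linarith⟩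
  have := Int.le_of_dvd (by omega) h4
  omega

/-- The place is rational. -/
lemma degree_eq_one (h : Q.IsRamified t x m s) (hspan : SpannedByPowers K t x m) :
    Q.degree = 1 := by
  have : Module.Free K (Q.valuationRing ⧸ Q.maximalIdeal) := Module.Free.of_divisionRing K _
  unfold Place.degree
  rw [finrank_eq_one_iff']
  refine ⟨1, ?_, fun w => ?_⟩
  · intro h1
    rw [← map_one (Ideal.Quotient.mk Q.maximalIdeal), Ideal.Quotient.eq_zero_iff_mem] at h1
    have h2 : Q.v (1 : F) < 1 := h1
    simp at h2
  · obtain ⟨f, rfl⟩ := Ideal.Quotient.mk_surjective w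
    obtain ⟨c, hc⟩ := h.exists_sub_lt_one hspan f.2
    refine ⟨c, ?_⟩
    rw [← Algebra.algebraMap_eq_smul_one]
    refine (Ideal.Quotient.eq (I := Q.maximalIdeal) (x := algebraMap K _ c)).2 ?_
    change Q.v (algebraMap K F c - f) < 1
    rwa [Valuation.map_sub_swap]

end Place.IsRamified

end TotallyRamified

end KummerDivisor

end

/-! ### The Kummer extension: its ramified places and the basis of powers of `x` -/

noncomputable section

namespace KummerDivisor

open WithZero IsDedekindDomain Polynomial IntermediateField

section Kummer

variable {K F : Type*} [Field K] [Field F] [Algebra K F]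

/-- The function field `F = K(x, y)` with `∏ i, (y - α i) = x ^ m`. -/
structure IsKummer {r : ℕ} (m : ℕ) (α : Fin r → K) (x y : F) : Prop where
  r_pos : 0 < r
  coprime : Nat.Coprime r m
  m_ne_zero : (m : K) ≠ 0
  injective : Function.Injective α
  transcendental : Transcendental K y
  adjoin_eq_top : IntermediateField.adjoin K {x, y} = ⊤
  prod_eq : ∏ i, (y - algebraMap K F (α i)) = x ^ m

lemma adjoin_sub_algebraMap (y : F) (c : K) : K⟮y - algebraMap K F c⟯ = K⟮y⟯ := by
  apply le_antisymm
  · rw [adjoin_simple_le_iff]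
    exact sub_mem (mem_adjoin_simple_self K y) (IntermediateField.algebraMap_mem _ c)
  · rw [adjoin_simple_le_iff]
    have := add_mem (mem_adjoin_simple_self K (y - algebraMap K F c))
      (IntermediateField.algebraMap_mem K⟮y - algebraMap K F c⟯ c)
    rwa [sub_add_cancel] at this

lemma adjoin_inv (y : F) : K⟮y⁻¹⟯ = K⟮y⟯ := by
  apply le_antisymm
  · rw [adjoin_simple_le_iff]
    exact inv_mem (mem_adjoin_simple_self K y)
  · rw [adjoin_simple_le_iff]
    have := inv_mem (mem_adjoin_simple_self K y⁻¹)
    rwa [inv_inv] at this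

namespace IsKummer

variable {r m : ℕ} {α : Fin r → K} {x y : F}

lemma m_pos (H : IsKummer m α x y) : 0 < m := by
  rcases Nat.eq_zero_or_pos m with rfl | h
  · exact absurd Nat.cast_zero H.m_ne_zero
  · exact h

lemma transcendental_sub (H : IsKummer m α x y) (c : K) :
    Transcendental K (y - algebraMap K F c) := by
  intro h
  apply H.transcendental
  have := h.add (isAlgebraic_algebraMap c)
  rwa [sub_add_cancel] at this

lemma sub_ne_zero (H : IsKummer m α x y) (c : K) : y - algebraMap K F c ≠ 0 := fun h =>
  H.transcendental_sub c (h ▸ isAlgebraic_zero)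

lemma y_ne_zero (H : IsKummer m α x y) : y ≠ 0 := fun h => H.transcendental (h ▸ isAlgebraic_zero)

lemma x_ne_zero (H : IsKummer m α x y) : x ≠ 0 := by
  rintro rfl
  have h := H.prod_eq
  rw [zero_pow H.m_pos.ne', Finset.prod_eq_zero_iff] at h
  obtain ⟨i, -, hi⟩ := h
  exact H.sub_ne_zero _ hi

variable (α y) in
/-- `∏ i, (y - α i)`, as an element of `K(y)`. -/
def radicand : K⟮y⟯ := ∏ i, (AdjoinSimple.gen K y - algebraMap K _ (α i))

lemma coe_radicand (H : IsKummer m α x y) : (radicand α y : F) = x ^ m := by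
  rw [← H.prod_eq, radicand, IntermediateField.coe_prod]
  rfl

lemma radicand_ne_zero (H : IsKummer m α x y) : radicand α y ≠ 0 := by
  intro h
  have := H.coe_radicand
  rw [h] at this
  exact pow_ne_zero m H.x_ne_zero this.symm

lemma aeval_pow_sub (H : IsKummer m α x y) : aeval x (X ^ m - C (radicand α y)) = 0 := by
  simp only [map_sub, map_pow, aeval_X, aeval_C]
  rw [← H.coe_radicand]
  exact sub_self _

lemma isIntegral_x (H : IsKummer m α x y) : IsIntegral K⟮y⟯ x :=
  ⟨X ^ m - C (radicand α y), monic_X_pow_sub_C _ H.m_pos.ne', H.aeval_pow_sub⟩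

lemma adjoin_x_eq_top (H : IsKummer m α x y) : K⟮y⟯⟮x⟯ = ⊤ := by
  apply IntermediateField.restrictScalars_injective K
  rw [adjoin_simple_adjoin_simple, Set.pair_comm, H.adjoin_eq_top, restrictScalars_top]

lemma finiteDimensional (H : IsKummer m α x y) : FiniteDimensional K⟮y⟯ F := by
  have h := adjoin.finiteDimensional H.isIntegral_x
  rw [H.adjoin_x_eq_top] at h
  exact Module.Finite.equiv (topEquiv (F := K⟮y⟯) (E := F)).toLinearEquiv

lemma isSeparable (H : IsKummer m α x y) : Algebra.IsSeparable K⟮y⟯ F := by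
  have hx : IsSeparable K⟮y⟯ x := by
    refine Polynomial.Separable.of_dvd (separable_X_pow_sub_C (radicand α y) (n := m) ?_
      H.radicand_ne_zero) (minpoly.dvd _ _ H.aeval_pow_sub)
    rw [← map_natCast (algebraMap K K⟮y⟯)]
    exact (_root_.map_ne_zero _).2 H.m_ne_zero
  have h := (isSeparable_adjoin_simple_iff_isSeparable K⟮y⟯ F).2 hx
  rw [H.adjoin_x_eq_top] at h
  exact AlgEquiv.Algebra.isSeparable (topEquiv (F := K⟮y⟯) (E := F))

lemma spannedByPowers (H : IsKummer m α x y) : SpannedByPowers K y x m := by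
  intro f
  have hf : f ∈ K⟮y⟯⟮x⟯ := by rw [H.adjoin_x_eq_top]; trivial
  have hf' : f ∈ Algebra.adjoin K⟮y⟯ {x} := by
    rw [← adjoin_simple_toSubalgebra_of_isAlgebraic H.isIntegral_x.isAlgebraic]
    exact hf
  rw [Algebra.adjoin_singleton_eq_range_aeval] at hf'
  obtain ⟨p, rfl⟩ := hf'
  have hmon : (X ^ m - C (radicand α y)).Monic := monic_X_pow_sub_C _ H.m_pos.ne'
  set q := p %ₘ (X ^ m - C (radicand α y)) with hq
  refine ⟨fun k => (q.coeff (k : ℕ) : F), fun k => (q.coeff (k : ℕ)).2, ?_⟩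
  have h1 : aeval x p = aeval x q := by
    conv_lhs => rw [← modByMonic_add_div p (X ^ m - C (radicand α y))]
    rw [map_add, map_mul, H.aeval_pow_sub, zero_mul, add_zero]
  have hdeg : q.natDegree < m := by
    have := natDegree_modByMonic_lt p hmon (fun h => by
      have := congrArg natDegree h
      rw [natDegree_X_pow_sub_C, natDegree_one] at this
      exact H.m_pos.ne' this)
    rwa [natDegree_X_pow_sub_C] at this
  change aeval x p = _
  rw [h1, aeval_eq_sum_range' hdeg, Finset.sum_range]
  rfl

lemma spannedByPowers_sub (H : IsKummer m α x y) (c : K) :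
    SpannedByPowers K (y - algebraMap K F c) x m := by
  have := H.spannedByPowers
  unfold SpannedByPowers at *
  rwa [adjoin_sub_algebraMap]

lemma spannedByPowers_inv (H : IsKummer m α x y) : SpannedByPowers K y⁻¹ x m := by
  have := H.spannedByPowers
  unfold SpannedByPowers at *
  rwa [adjoin_inv]

/-! ### The places above the zeros of the radicand and above infinity -/

lemma v_x_pow (H : IsKummer m α x y) (Q : Place K F) :
    Q.v x ^ m = ∏ i, Q.v (y - algebraMap K F (α i)) := by
  rw [← map_pow, ← H.prod_eq, map_prod]

lemma v_sub_eq_one (H : IsKummer m α x y) {Q : Place K F} {i j : Fin r} (hij : j ≠ i)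
    (h : Q.v (y - algebraMap K F (α i)) < 1) : Q.v (y - algebraMap K F (α j)) = 1 := by
  refine Q.v_eq_one_of_sub_lt_one (c := α i - α j)
    (_root_.sub_ne_zero.2 fun h => hij (H.injective h).symm) ?_
  have : y - algebraMap K F (α j) - algebraMap K F (α i - α j) = y - algebraMap K F (α i) := by
    rw [map_sub (algebraMap K F)]
    ring
  rwa [this]

/-- The `α j` are distinct, so the other factors of the radicand are units at `Q` and `v(x)^m = v(y
- α i)`. -/
lemma isRamified_of_lt_one (H : IsKummer m α x y) {Q : Place K F} {i : Fin r}
    (h : Q.v (y - algebraMap K F (α i)) < 1) :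
    Q.IsRamified (y - algebraMap K F (α i)) x m 1 where
  pos := H.m_pos
  coprime := isCoprime_one_right
  ne_zero := H.x_ne_zero
  t_ne_zero := H.sub_ne_zero _
  lt_one := h
  pow_eq := by
    rw [H.v_x_pow, zpow_one]
    exact Fintype.prod_eq_single i fun j hj => H.v_sub_eq_one hj h

lemma v_sub_eq_of_one_lt {Q : Place K F} (h : 1 < Q.v y) (c : K) :
    Q.v (y - algebraMap K F c) = Q.v y :=
  Q.v.map_sub_eq_of_lt_left ((Q.v_algebraMap_le_one c).trans_lt h)

/-- All `r` factors have the value of `y`, so `v(x)^m = v(y⁻¹)^(-r)`; the ramification is total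
because `gcd(r, m) = 1`. -/
lemma isRamified_of_one_lt (H : IsKummer m α x y) {Q : Place K F} (h : 1 < Q.v y) :
    Q.IsRamified y⁻¹ x m (-(r : ℤ)) where
  pos := H.m_pos
  coprime := ((Nat.isCoprime_iff_coprime.2 H.coprime).symm).neg_right
  ne_zero := H.x_ne_zero
  t_ne_zero := inv_ne_zero H.y_ne_zero
  lt_one := by
    rw [map_inv₀]
    exact inv_lt_one_of_one_lt₀ h
  pow_eq := by
    rw [H.v_x_pow, Finset.prod_congr rfl fun i _ => v_sub_eq_of_one_lt h (α i)]
    simp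

lemma exists_place (H : IsKummer m α x y) (i : Fin r) :
    ∃ Q : Place K F, Q.v (y - algebraMap K F (α i)) < 1 := by
  have h1 := H.finiteDimensional
  have h2 := H.isSeparable
  rw [← adjoin_sub_algebraMap y (α i)] at h1 h2
  exact exists_place_v_lt_one (H.transcendental_sub (α i))

lemma exists_infty (H : IsKummer m α x y) : ∃ Q : Place K F, 1 < Q.v y := by
  have h1 := H.finiteDimensional
  have h2 := H.isSeparable
  rw [← adjoin_inv y] at h1 h2
  obtain ⟨Q, hQ⟩ := exists_place_v_lt_one (t := y⁻¹) fun h =>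
    H.transcendental (by simpa using h.inv)
  refine ⟨Q, ?_⟩
  rw [map_inv₀] at hQ
  have h0 : Q.v y ≠ 0 := (Valuation.ne_zero_iff _).2 H.y_ne_zero
  exact (inv_lt_one₀ (zero_lt_iff.2 h0)).1 hQ

/-- The place at which `x` and `y - α i` vanish. -/
def place (H : IsKummer m α x y) (i : Fin r) : Place K F := (H.exists_place i).choose

/-- The place at infinity. -/
def infty (H : IsKummer m α x y) : Place K F := H.exists_infty.choose

lemma isRamified_place (H : IsKummer m α x y) (i : Fin r) :
    (H.place i).IsRamified (y - algebraMap K F (α i)) x m 1 :=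
  H.isRamified_of_lt_one (H.exists_place i).choose_spec

lemma one_lt_infty (H : IsKummer m α x y) : 1 < H.infty.v y := H.exists_infty.choose_spec

lemma isRamified_infty (H : IsKummer m α x y) : H.infty.IsRamified y⁻¹ x m (-(r : ℤ)) :=
  H.isRamified_of_one_lt H.one_lt_infty

lemma eq_place (H : IsKummer m α x y) {Q : Place K F} {i : Fin r}
    (h : Q.v (y - algebraMap K F (α i)) < 1) : Q = H.place i :=
  (H.isRamified_of_lt_one h).unique (H.isRamified_place i) (H.spannedByPowers_sub _)

lemma eq_infty (H : IsKummer m α x y) {Q : Place K F} (h : 1 < Q.v y) : Q = H.infty :=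
  (H.isRamified_of_one_lt h).unique H.isRamified_infty H.spannedByPowers_inv

lemma place_injective (H : IsKummer m α x y) : Function.Injective H.place := by
  intro i j h
  by_contra hij
  have h1 := H.v_sub_eq_one (Ne.symm hij) (H.isRamified_place i).lt_one
  have h2 := (H.isRamified_place j).lt_one
  rw [← h, h1] at h2
  exact lt_irrefl _ h2

lemma place_ne_infty (H : IsKummer m α x y) (i : Fin r) : H.place i ≠ H.infty := by
  intro h
  have h1 := (H.isRamified_place i).lt_one
  rw [h, v_sub_eq_of_one_lt H.one_lt_infty] at h1
  exact lt_asymm h1 H.one_lt_infty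

lemma v_place_x (H : IsKummer m α x y) (i : Fin r) : (H.place i).v x = exp (-1) :=
  ((H.isRamified_place i).v_eq (H.spannedByPowers_sub _)).2

lemma v_place_sub (H : IsKummer m α x y) (i : Fin r) :
    (H.place i).v (y - algebraMap K F (α i)) = exp (-(m : ℤ)) :=
  ((H.isRamified_place i).v_eq (H.spannedByPowers_sub _)).1

lemma v_infty_x (H : IsKummer m α x y) : H.infty.v x = exp (r : ℤ) := by
  have := (H.isRamified_infty.v_eq H.spannedByPowers_inv).2
  rwa [neg_neg] at this

lemma v_infty_y (H : IsKummer m α x y) : H.infty.v y = exp (m : ℤ) := by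
  have := (H.isRamified_infty.v_eq H.spannedByPowers_inv).1
  rwa [map_inv₀, exp_neg, inv_inj] at this

lemma degree_place (H : IsKummer m α x y) (i : Fin r) : (H.place i).degree = 1 :=
  (H.isRamified_place i).degree_eq_one (H.spannedByPowers_sub _)

lemma degree_infty (H : IsKummer m α x y) : H.infty.degree = 1 :=
  H.isRamified_infty.degree_eq_one H.spannedByPowers_inv

lemma isAt_iff (H : IsKummer m α x y) (i : Fin r) (Q : Place K F) :
    Q.IsAt x y 0 (α i) ↔ Q = H.place i := by
  constructor
  · rintro ⟨-, h⟩
    exact H.eq_place h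
  · rintro rfl
    refine ⟨?_, (H.isRamified_place i).lt_one⟩
    rw [map_zero, _root_.sub_zero, H.v_place_x, ← exp_zero, exp_lt_exp]
    norm_num

lemma v_term_le_place (H : IsKummer m α x y) (i : Fin r) {g : Fin m → F} (hg : ∀ k, g k ∈ K⟮y⟯)
    (k : Fin m) : (H.place i).v (g k * x ^ (k : ℕ)) ≤ (H.place i).v (∑ j, g j * x ^ (j : ℕ)) :=
  (H.isRamified_place i).v_term_le (by rwa [adjoin_sub_algebraMap]) k

lemma v_term_le_infty (H : IsKummer m α x y) {g : Fin m → F} (hg : ∀ k, g k ∈ K⟮y⟯)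
    (k : Fin m) : H.infty.v (g k * x ^ (k : ℕ)) ≤ H.infty.v (∑ j, g j * x ^ (j : ℕ)) :=
  H.isRamified_infty.v_term_le (by rwa [adjoin_inv]) k

lemma finite_residueField [Finite K] (H : IsKummer m α x y) (Q : Place K F) :
    Module.Finite K Q.residueField := by
  rcases le_or_gt (Q.v y) 1 with h | h
  · have := H.finiteDimensional
    have := H.isSeparable
    exact finite_residueField_of_v_le_one H.transcendental Q h
  · rw [H.eq_infty h]
    have : Module.Free K H.infty.residueField := Module.Free.of_divisionRing K _
    exact Module.finite_of_finrank_pos (H.degree_infty.symm ▸ one_pos :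
      0 < Place.degree H.infty)

/-! ### The basis of powers of `x` -/

/-- The absence of cancellation at infinity is used here as linear independence of the powers of
`x`. -/
lemma eq_zero_of_sum_eq_zero (H : IsKummer m α x y) {g : Fin m → F} (hg : ∀ k, g k ∈ K⟮y⟯)
    (h : ∑ j, g j * x ^ (j : ℕ) = 0) (k : Fin m) : g k = 0 := by
  have h1 := H.v_term_le_infty hg k
  rw [h, map_zero, le_zero_iff, Valuation.zero_iff] at h1
  exact (mul_eq_zero.1 h1).resolve_right (pow_ne_zero _ H.x_ne_zero)

/-- The basis `1, x, …, x ^ (m - 1)` of `F` over `K(y)`. -/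
lemma exists_basis (H : IsKummer m α x y) :
    ∃ b : Module.Basis (Fin m) K⟮y⟯ F, ∀ k, b k = x ^ (k : ℕ) := by
  have hli : LinearIndependent K⟮y⟯ fun k : Fin m => x ^ (k : ℕ) := by
    rw [Fintype.linearIndependent_iff]
    intro g hg k
    exact Subtype.ext (H.eq_zero_of_sum_eq_zero (g := fun k => (g k : F)) (fun k => (g k).2) hg k)
  refine ⟨Module.Basis.mk hli ?_, fun k => Module.Basis.mk_apply hli _ k⟩
  rintro f -
  obtain ⟨g, hg, rfl⟩ := H.spannedByPowers f
  refine Submodule.sum_mem _ fun k _ => ?_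
  exact Submodule.smul_mem _ (⟨g k, hg k⟩ : K⟮y⟯)
    (Submodule.subset_span ⟨k, rfl⟩)

lemma finrank_eq (H : IsKummer m α x y) : Module.finrank K⟮y⟯ F = m := by
  obtain ⟨b, -⟩ := H.exists_basis
  simpa using Module.finrank_eq_card_basis b

/-- Up to scalars, multiplication by `x ^ j` permutes the basis by a cyclic shift without fixed
index, so its matrix has zero diagonal. -/
lemma trace_pow (H : IsKummer m α x y) {j : ℕ} (hj : 0 < j) (hjm : j < m) :
    Algebra.trace K⟮y⟯ F (x ^ j) = 0 := by
  obtain ⟨b, hb⟩ := H.exists_basis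
  rw [Algebra.trace_eq_matrix_trace b, Matrix.trace]
  refine Finset.sum_eq_zero fun i _ => ?_
  rw [Matrix.diag_apply, Algebra.leftMulMatrix_eq_repr_mul, hb, ← pow_add]
  rcases lt_or_ge (j + i) m with h | h
  · have : x ^ (j + (i : ℕ)) = b ⟨j + i, h⟩ := (hb ⟨j + i, h⟩).symm
    rw [this, b.repr_self, Finsupp.single_eq_of_ne]
    intro h
    have := congrArg Fin.val h
    simp only at this
    omega
  · have hlt : j + i - m < m := by omega
    have : x ^ (j + (i : ℕ)) = radicand α y • b ⟨j + i - m, hlt⟩ := by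
      rw [hb, Algebra.smul_def]
      change _ = (radicand α y : F) * _
      rw [H.coe_radicand, ← pow_add]
      congr 1
      simp only
      omega
    rw [this, map_smul, b.repr_self, Finsupp.smul_apply, Finsupp.single_eq_of_ne, smul_zero]
    intro h
    have := congrArg Fin.val h
    simp only at this
    omega

/-- The coefficients of a function without finite poles have denominator dividing the radicand. -/
lemma exists_aeval_eq_mul (H : IsKummer m α x y) {g : Fin m → F} (hg : ∀ k, g k ∈ K⟮y⟯)
    (hf : ∀ Q : Place K F, Q.v y ≤ 1 → Q.v (∑ j, g j * x ^ (j : ℕ)) ≤ 1) :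
    ∀ k, ∃ w : K[X], aeval y w = x ^ m * g k := by
  intro k
  have hk := k.2
  have h1 := H.finiteDimensional
  have h2 := H.isSeparable
  have h3 := isPrincipalIdealRing_adjoin H.transcendental
  -- The factor `x ^ (m - k)` moves the `k`-th term to `g k * x ^ m ∈ K(y)`, and the trace then
  -- isolates it.
  have hintegral : IsIntegral (Algebra.adjoin K {y})
      ((∑ j, g j * x ^ (j : ℕ)) * x ^ (m - (k : ℕ))) := by
    refine isIntegral_of_forall_v_le_one H.transcendental fun Q hQ => ?_
    have hx : Q.v x ≤ 1 := by
      have hp := H.v_x_pow Q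
      have : Q.v x ^ m ≤ 1 := by
        rw [hp]
        exact Finset.prod_le_one' fun i _ =>
          (Q.v.map_sub _ _).trans (max_le hQ (Q.v_algebraMap_le_one _))
      exact (pow_le_one_iff H.m_pos.ne').1 this
    rw [map_mul, map_pow]
    exact mul_le_one' (hf Q hQ) (pow_le_one' hx _)
  open scoped algebraAdjoinAdjoin in
  have htr := Algebra.isIntegral_trace (L := K⟮y⟯) hintegral
  -- The exponent is `m - (k - j)` for `j < k` and `m + (j - k)` for `j > k`. Once `x ^ m` is
  -- absorbed into `K(y)`, both leave a power of trace zero.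
  have hterm : ∀ j ∈ Finset.univ, Algebra.trace K⟮y⟯ F (g j * x ^ (j : ℕ) * x ^ (m - (k : ℕ)))
      = if j = k then (m : K⟮y⟯) * (radicand α y * ⟨g k, hg k⟩) else 0 := by
    intro j _
    have hj := j.2
    split
    · next hjk =>
      subst hjk
      have : g j * x ^ (j : ℕ) * x ^ (m - (j : ℕ)) = algebraMap K⟮y⟯ F (radicand α y * ⟨g j, hg j⟩) := by
        rw [map_mul]
        change _ = (radicand α y : F) * g j
        rw [H.coe_radicand, mul_assoc, ← pow_add, mul_comm]
        congr 2
        omega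
      rw [this, Algebra.trace_algebraMap, H.finrank_eq, nsmul_eq_mul]
    · next hjk =>
      rcases lt_or_gt_of_ne (Fin.val_ne_of_ne hjk) with h | h
      · have : g j * x ^ (j : ℕ) * x ^ (m - (k : ℕ)) = (⟨g j, hg j⟩ : K⟮y⟯) • x ^ (m - ((k : ℕ) - j)) := by
          rw [Algebra.smul_def]
          change _ = g j * _
          rw [mul_assoc, ← pow_add]
          congr 2
          omega
        rw [this, map_smul, H.trace_pow (by omega) (by omega), smul_zero]
      · have : g j * x ^ (j : ℕ) * x ^ (m - (k : ℕ))
            = (radicand α y * ⟨g j, hg j⟩ : K⟮y⟯) • x ^ ((j : ℕ) - k) := by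
          rw [Algebra.smul_def, map_mul]
          change _ = (radicand α y : F) * g j * _
          rw [H.coe_radicand, mul_comm (x ^ m), mul_assoc, mul_assoc, ← pow_add, ← pow_add]
          congr 2
          omega
        rw [this, map_smul, H.trace_pow (by omega) (by omega), smul_zero]
  rw [Finset.sum_mul, map_sum, Finset.sum_congr rfl hterm,
    Finset.sum_ite_eq_of_mem' _ _ _ (Finset.mem_univ k)] at htr
  open scoped algebraAdjoinAdjoin in
  obtain ⟨a, ha⟩ := IsIntegrallyClosed.isIntegral_iff.1 htr
  obtain ⟨w, hw⟩ := exists_aeval_adjoin y a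
  have ha' := congrArg (fun z : K⟮y⟯ => (z : F)) ha
  change (a : F) = _ at ha'
  rw [hw, aeval_adjoin_coe] at ha'
  -- The trace of an element of `K(y)` carries the factor `m`, which is invertible in `K`.
  refine ⟨C (m : K)⁻¹ * w, ?_⟩
  rw [map_mul, ha', aeval_C]
  change _ * ((m : F) * ((radicand α y : F) * g k)) = _
  rw [H.coe_radicand, ← mul_assoc, ← map_natCast (algebraMap K F) m, ← map_mul,
    inv_mul_cancel₀ H.m_ne_zero, map_one, one_mul]

end IsKummer

end Kummer

end KummerDivisor

end

/-! ### The dimension formula for divisors supported at the ramified places -/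

noncomputable section

namespace KummerDivisor

open WithZero IsDedekindDomain Polynomial IntermediateField

namespace IsKummer

variable {K F : Type*} [Field K] [Field F] [Algebra K F]
variable {r m : ℕ} {α : Fin r → K} {x y : F}

/-! ### Values of polynomials in `y` -/

lemma v_infty_aeval (H : IsKummer m α x y) {p : K[X]} (hp : p ≠ 0) :
    H.infty.v (aeval y p) = exp ((m : ℤ) * p.natDegree) := by
  have hterm : ∀ j, p.coeff j ≠ 0 → H.infty.v (p.coeff j • y ^ j) = exp ((m : ℤ) * j) := by
    intro j hj
    rw [Algebra.smul_def, map_mul, H.infty.trivial_on_constants _ hj, one_mul, map_pow, H.v_infty_y,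
      ← exp_nsmul, nsmul_eq_mul, mul_comm]
  have hm : (0 : ℤ) < m := by exact_mod_cast H.m_pos
  rw [aeval_eq_sum_range]
  apply le_antisymm
  · refine H.infty.v.map_sum_le fun j hj => ?_
    by_cases h0 : p.coeff j = 0
    · simp [h0]
    · rw [hterm j h0, exp_le_exp]
      refine mul_le_mul_of_nonneg_left ?_ hm.le
      rw [Finset.mem_range] at hj
      omega
  · rw [← hterm _ (leadingCoeff_ne_zero.2 hp)]
    refine map_le_map_sum_of_injOn H.infty.v (Finset.range (p.natDegree + 1))
      (fun j => p.coeff j • y ^ j) (fun i _ j _ hi hij => ?_) _ (Finset.self_mem_range_succ _)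
    have hi0 : p.coeff i ≠ 0 := fun h => hi (by simp [h])
    have hj0 : p.coeff j ≠ 0 := fun h => by
      rw [h, zero_smul, map_zero, Valuation.zero_iff] at hij
      exact hi hij
    rw [hterm i hi0, hterm j hj0, exp_inj] at hij
    exact_mod_cast mul_left_cancel₀ hm.ne' hij

lemma v_place_y_le_one (H : IsKummer m α x y) (i : Fin r) : (H.place i).v y ≤ 1 := by
  have h := (H.place i).v.map_add (y - algebraMap K F (α i)) (algebraMap K F (α i))
  rw [sub_add_cancel] at h
  exact h.trans (max_le (H.isRamified_place i).lt_one.le ((H.place i).v_algebraMap_le_one _))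

lemma v_place_aeval (H : IsKummer m α x y) (i : Fin r) {p : K[X]} (hp : p ≠ 0) :
    (H.place i).v (aeval y p) = exp (-((m : ℤ) * p.rootMultiplicity (α i))) := by
  obtain ⟨q, hq, hnd⟩ := exists_eq_pow_rootMultiplicity_mul_and_not_dvd p hp (α i)
  have hq0 : q.eval (α i) ≠ 0 := fun h => hnd (dvd_iff_isRoot.2 h)
  have h1 : (H.place i).v (aeval y q) = 1 := by
    refine (H.place i).v_eq_one_of_sub_lt_one hq0 ?_
    obtain ⟨u, hu⟩ := X_sub_C_dvd_sub_C_eval (a := α i) (p := q)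
    have : aeval y q - algebraMap K F (q.eval (α i))
        = (y - algebraMap K F (α i)) * aeval y u := by
      simpa using congrArg (aeval y) hu
    rw [this, map_mul]
    exact (mul_le_of_le_one_right' ((H.place i).v_aeval_le_one (H.v_place_y_le_one i) u)).trans_lt
      (H.isRamified_place i).lt_one
  have h2 : aeval y p = (y - algebraMap K F (α i)) ^ p.rootMultiplicity (α i) * aeval y q := by
    conv_lhs => rw [hq]
    simp
  rw [h2, map_mul, map_pow, h1, mul_one, H.v_place_sub, ← exp_nsmul, nsmul_eq_mul]
  congr 1
  ring

/-- A rational function in `y` whose denominator divides a power of the radicand and without poles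
at the zeros of the radicand is a polynomial. -/
lemma exists_aeval_eq (H : IsKummer m α x y) {G : F} {M : ℕ} {q : K[X]}
    (hq : aeval y q = (x ^ m) ^ M * G) (hG : ∀ i, (H.place i).v G ≤ 1) :
    ∃ p : K[X], aeval y p = G := by
  by_cases hG0 : G = 0
  · exact ⟨0, by simp [hG0]⟩
  have hq0 : q ≠ 0 := by
    rintro rfl
    rw [map_zero] at hq
    exact mul_ne_zero (pow_ne_zero _ (pow_ne_zero _ H.x_ne_zero)) hG0 hq.symm
  have hm : (0 : ℤ) < m := by exact_mod_cast H.m_pos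
  have hdvd : ∏ i, (X - C (α i)) ^ M ∣ q := by
    refine Finset.prod_dvd_of_coprime (fun i _ j _ hij => ?_) fun i _ => ?_
    · exact (isCoprime_X_sub_C_of_isUnit_sub
        (IsUnit.mk0 _ (_root_.sub_ne_zero.2 fun h => hij (H.injective h)))).pow
    · rw [← le_rootMultiplicity_iff hq0]
      have h1 := H.v_place_aeval i hq0
      rw [hq, map_mul, map_pow, map_pow, H.v_place_x, ← exp_nsmul, ← exp_nsmul] at h1
      have h2 := mul_le_of_le_one_right' (a := exp (M • m • (-1 : ℤ))) (hG i)
      rw [h1, exp_le_exp] at h2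
      simp only [nsmul_eq_mul] at h2
      have : (m : ℤ) * M ≤ m * (rootMultiplicity (α i) q : ℤ) := by linarith
      exact_mod_cast le_of_mul_le_mul_left this hm
  obtain ⟨p, rfl⟩ := hdvd
  refine ⟨p, ?_⟩
  have h1 : aeval y (∏ i, (X - C (α i)) ^ M) = (x ^ m) ^ M := by
    rw [← H.prod_eq, map_prod, ← Finset.prod_pow]
    simp
  rw [map_mul, h1] at hq
  exact mul_left_cancel₀ (pow_ne_zero _ (pow_ne_zero _ H.x_ne_zero)) hq

/-! ### Divisors supported at the totally ramified places -/

/-- The divisor `∑ i, a i • P i + n • P_∞`. -/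
def divisor (H : IsKummer m α x y) (a : Fin r → ℕ) (n : ℕ) : Divisor K F :=
  ∑ i, Finsupp.single (H.place i) (a i : ℤ) + Finsupp.single H.infty (n : ℤ)

lemma divisor_place (H : IsKummer m α x y) (a : Fin r → ℕ) (n : ℕ) (i : Fin r) :
    H.divisor a n (H.place i) = a i := by
  classical
  rw [divisor, Finsupp.add_apply, Finsupp.finsetSum_apply,
    Finsupp.single_eq_of_ne (H.place_ne_infty i), add_zero]
  rw [Fintype.sum_eq_single i fun j hj => Finsupp.single_eq_of_ne fun h =>
    hj (H.place_injective h).symm, Finsupp.single_eq_same]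

lemma divisor_infty (H : IsKummer m α x y) (a : Fin r → ℕ) (n : ℕ) :
    H.divisor a n H.infty = n := by
  rw [divisor, Finsupp.add_apply, Finsupp.finsetSum_apply, Finsupp.single_eq_same,
    Finset.sum_eq_zero fun i _ => Finsupp.single_eq_of_ne (H.place_ne_infty i).symm, zero_add]

lemma divisor_of_ne (H : IsKummer m α x y) (a : Fin r → ℕ) (n : ℕ) {Q : Place K F}
    (h : ∀ i, Q ≠ H.place i) (h' : Q ≠ H.infty) : H.divisor a n Q = 0 := by
  rw [divisor, Finsupp.add_apply, Finsupp.finsetSum_apply, Finsupp.single_eq_of_ne h',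
    Finset.sum_eq_zero fun i _ => Finsupp.single_eq_of_ne (h i), zero_add]

lemma degree_divisor (H : IsKummer m α x y) (a : Fin r → ℕ) (n : ℕ) :
    (H.divisor a n).degree = ∑ i, (a i : ℤ) + n := by
  simp [divisor, Divisor.degree_add, Divisor.degree_sum, Divisor.degree_single, H.degree_place,
    H.degree_infty]

variable (m) in
/-- The pole order at `y = α i` allowed for the coefficient of `x ^ k`. -/
def poleBound (a : Fin r → ℕ) (k : ℕ) (i : Fin r) : ℕ := (a i + k) / m

variable (m) in
/-- The dimension contributed by `x ^ k` to the Riemann–Roch space. -/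
def termDim (a : Fin r → ℕ) (n k : ℕ) : ℕ :=
  (1 + ∑ i, (poleBound m a k i : ℤ) + ((n : ℤ) - r * k) / m).toNat

variable (m α y) in
/-- The denominator of the coefficient of `x ^ k`. -/
def poleFactor (a : Fin r → ℕ) (k : ℕ) : F := ∏ i, (y - algebraMap K F (α i)) ^ poleBound m a k i

lemma poleFactor_ne_zero (H : IsKummer m α x y) (a : Fin r → ℕ) (k : ℕ) :
    poleFactor m α y a k ≠ 0 :=
  Finset.prod_ne_zero_iff.2 fun _ _ => pow_ne_zero _ (H.sub_ne_zero _)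

lemma poleFactor_mem (a : Fin r → ℕ) (k : ℕ) : poleFactor m α y a k ∈ K⟮y⟯ :=
  prod_mem fun _ _ => pow_mem (sub_mem (mem_adjoin_simple_self K y)
    (IntermediateField.algebraMap_mem _ _)) _

lemma aeval_mem (p : K[X]) : aeval y p ∈ K⟮y⟯ :=
  algebra_adjoin_le_adjoin K {y} (by
    rw [Algebra.adjoin_singleton_eq_range_aeval]
    exact ⟨p, rfl⟩)

lemma v_place_poleFactor (H : IsKummer m α x y) (a : Fin r → ℕ) (k : ℕ) (i : Fin r) :
    (H.place i).v (poleFactor m α y a k) = exp (-((m : ℤ) * poleBound m a k i)) := by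
  rw [poleFactor, map_prod, Fintype.prod_eq_single i fun j hj => ?_]
  · rw [map_pow, H.v_place_sub, ← exp_nsmul, nsmul_eq_mul]
    congr 1
    ring
  · rw [map_pow, H.v_sub_eq_one hj (H.isRamified_place i).lt_one, one_pow]

lemma v_infty_poleFactor (H : IsKummer m α x y) (a : Fin r → ℕ) (k : ℕ) :
    H.infty.v (poleFactor m α y a k) = exp ((m : ℤ) * ∑ i, (poleBound m a k i : ℤ)) := by
  rw [poleFactor, map_prod]
  have : ∀ i ∈ Finset.univ, H.infty.v ((y - algebraMap K F (α i)) ^ poleBound m a k i)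
      = exp (m : ℤ) ^ poleBound m a k i := fun i _ => by
    rw [map_pow, v_sub_eq_of_one_lt H.one_lt_infty, H.v_infty_y]
  rw [Finset.prod_congr rfl this, Finset.prod_pow_eq_pow_sum, ← exp_nsmul, nsmul_eq_mul]
  congr 1
  push_cast
  ring

lemma v_eq_one_of_ne (H : IsKummer m α x y) {Q : Place K F}
    (h : ∀ i, Q ≠ H.place i) (h' : Q ≠ H.infty) :
    Q.v y ≤ 1 ∧ (∀ i, Q.v (y - algebraMap K F (α i)) = 1) ∧ Q.v x = 1 := by
  have hy : Q.v y ≤ 1 := not_lt.1 fun hlt => h' (H.eq_infty hlt)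
  have h1 : ∀ i, Q.v (y - algebraMap K F (α i)) = 1 := fun i =>
    ((Q.v.map_sub _ _).trans (max_le hy (Q.v_algebraMap_le_one _))).antisymm
      (not_lt.1 fun hlt => h i (H.eq_place hlt))
  refine ⟨hy, h1, ?_⟩
  have := H.v_x_pow Q
  rw [Finset.prod_congr rfl fun i _ => h1 i, Finset.prod_const_one] at this
  exact (pow_eq_one_iff.1 this).resolve_right H.m_pos.ne'

/-- At `P_i` this is `m⌊(a_i + k)/m⌋ ≤ a_i + k`; at infinity it is the degree bound encoded in
`termDim`; elsewhere the denominator and `x` are units. -/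
lemma term_mem (H : IsKummer m α x y) (a : Fin r → ℕ) (n : ℕ) (k : ℕ) {p : K[X]}
    (hp : p ∈ degreeLT K (termDim m a n k)) :
    aeval y p / poleFactor m α y a k * x ^ k ∈ riemannRochSpace (H.divisor a n) := by
  classical
  intro Q
  rw [map_mul, map_div₀, map_pow]
  by_cases hQi : ∃ i, Q = H.place i
  · obtain ⟨i, rfl⟩ := hQi
    have h1 := (H.place i).v_aeval_le_one (H.v_place_y_le_one i) p
    rw [H.divisor_place, H.v_place_poleFactor, H.v_place_x, div_eq_mul_inv, ← exp_neg, mul_assoc,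
      ← exp_nsmul, ← exp_add]
    refine (mul_le_of_le_one_left' h1).trans ?_
    rw [exp_le_exp, neg_neg, nsmul_eq_mul]
    have h2 : m * poleBound m a k i ≤ a i + k := Nat.mul_div_le _ _
    have h3 : (m : ℤ) * poleBound m a k i ≤ a i + k := by exact_mod_cast h2
    linarith
  push Not at hQi
  by_cases hQ : Q = H.infty
  · subst hQ
    by_cases hp0 : p = 0
    · simp [hp0]
    rw [H.divisor_infty, H.v_infty_aeval hp0, H.v_infty_poleFactor, H.v_infty_x, div_eq_mul_inv,
      ← exp_neg, ← exp_nsmul, ← exp_add, ← exp_add, exp_le_exp, nsmul_eq_mul]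
    rw [mem_degreeLT, degree_eq_natDegree hp0, Nat.cast_lt, termDim, Int.lt_toNat] at hp
    have hm : (0 : ℤ) < m := by exact_mod_cast H.m_pos
    have h1 := Int.mul_ediv_self_le (x := (n : ℤ) - r * k) hm.ne'
    have h2 : (m : ℤ) * p.natDegree
        ≤ m * (∑ i, (poleBound m a k i : ℤ) + ((n : ℤ) - r * k) / m) :=
      mul_le_mul_of_nonneg_left (by linarith) hm.le
    rw [mul_add] at h2
    linarith
  · obtain ⟨hy, h1, hx⟩ := H.v_eq_one_of_ne hQi hQ
    rw [H.divisor_of_ne a n hQi hQ, exp_zero, hx, one_pow, mul_one, poleFactor, map_prod]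
    simp only [map_pow, h1, one_pow, Finset.prod_const_one, div_one]
    exact Q.v_aeval_le_one hy p

/-- The trace argument confines the finite poles of each coefficient to the zeros of the radicand.
The absence of cancellation at the `P_i` then bounds the denominators, and at infinity the degrees.
-/
lemma exists_eq_sum_of_mem (H : IsKummer m α x y) (a : Fin r → ℕ) (n : ℕ) {f : F}
    (hf : f ∈ riemannRochSpace (H.divisor a n)) :
    ∃ p : Fin m → K[X], (∀ k : Fin m, p k ∈ degreeLT K (termDim m a n k)) ∧
      f = ∑ k, aeval y (p k) / poleFactor m α y a k * x ^ (k : ℕ) := by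
  classical
  obtain ⟨g, hg, rfl⟩ := H.spannedByPowers f
  have hm : (0 : ℤ) < m := by exact_mod_cast H.m_pos
  set G : Fin m → F := fun k => g k * poleFactor m α y a k with hGdef
  have hGmem : ∀ k, G k ∈ K⟮y⟯ := fun k => mul_mem (hg k) (poleFactor_mem a k)
  -- A crude exponent: `(x ^ m) ^ M` has order `mM ≥ a i` at `P_i` and clears all finite poles of
  -- `f`.
  let M := ∑ i, a i
  have hM : ∀ i, a i ≤ M := fun i => Finset.single_le_sum (f := a) (fun _ _ => Nat.zero_le _)
    (Finset.mem_univ i)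
  have hpow : (x ^ m) ^ M ∈ K⟮y⟯ := by
    rw [← H.coe_radicand]
    exact pow_mem (radicand α y).2 _
  have hpoly : ∀ k, ∃ w : K[X], aeval y w = x ^ m * ((x ^ m) ^ M * g k) := by
    refine H.exists_aeval_eq_mul (g := fun k => (x ^ m) ^ M * g k)
      (fun k => mul_mem hpow (hg k)) fun Q hQ => ?_
    have hsum : ∑ j, (x ^ m) ^ M * g j * x ^ (j : ℕ)
        = (x ^ m) ^ M * ∑ j, g j * x ^ (j : ℕ) := by
      rw [Finset.mul_sum]
      exact Finset.sum_congr rfl fun j _ => by ring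
    rw [hsum, map_mul, map_pow, map_pow]
    have hfQ := hf Q
    have hQinf : Q ≠ H.infty := by
      rintro rfl
      exact (not_le.2 H.one_lt_infty) hQ
    by_cases hQi : ∃ i, Q = H.place i
    · obtain ⟨i, rfl⟩ := hQi
      rw [H.divisor_place] at hfQ
      refine (mul_le_mul_right hfQ _).trans ?_
      rw [H.v_place_x, ← exp_nsmul, ← exp_nsmul, ← exp_add, ← exp_zero, exp_le_exp]
      have h1 : (a i : ℤ) ≤ M := by exact_mod_cast hM i
      have h2 : (M : ℤ) ≤ M * m := le_mul_of_one_le_right (by positivity) (by omega)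
      simp only [nsmul_eq_mul]
      linarith
    · push Not at hQi
      obtain ⟨-, -, hx⟩ := H.v_eq_one_of_ne hQi hQinf
      rw [H.divisor_of_ne a n hQi hQinf, exp_zero] at hfQ
      rwa [hx, one_pow, one_pow, one_mul]
  -- The order of `G k` at `P_i` is a multiple `mc` of `m`, and the pole bound gives `mc > -m`,
  -- whence `c ≥ 0`.
  have hGv : ∀ k i, (H.place i).v (G k) ≤ 1 := by
    intro k i
    by_cases h0 : G k = 0
    · simp [h0]
    obtain ⟨c, hc⟩ := (H.isRamified_place i).exists_v_term_eq (H.spannedByPowers_sub _)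
      (g := G k) (by rw [adjoin_sub_algebraMap]; exact hGmem k) h0 0
    rw [pow_zero, mul_one, Nat.cast_zero, mul_zero, add_zero] at hc
    have h1 := (H.v_term_le_place i hg k).trans (hf (H.place i))
    have h2 : g k * x ^ (k : ℕ) = G k / poleFactor m α y a k * x ^ (k : ℕ) := by
      rw [hGdef]
      simp only
      rw [mul_div_cancel_right₀ _ (H.poleFactor_ne_zero a k)]
    rw [h2, map_mul, map_div₀, map_pow, hc, H.v_place_poleFactor, H.v_place_x, H.divisor_place,
      div_eq_mul_inv, ← exp_neg, ← exp_nsmul, ← exp_add, ← exp_add, exp_le_exp, nsmul_eq_mul] at h1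
    have h3 : a i + (k : ℕ) < m * (poleBound m a k i + 1) :=
      Nat.lt_mul_div_succ _ H.m_pos
    have h4 : (a i : ℤ) + (k : ℕ) < m * (poleBound m a k i + 1) := by exact_mod_cast h3
    rw [hc, ← exp_zero, exp_le_exp, neg_nonpos]
    have h5 : (m : ℤ) * 0 < m * (c + 1) := by linarith
    have h6 := lt_of_mul_lt_mul_left h5 hm.le
    exact mul_nonneg hm.le (by omega)
  have hp : ∀ k, ∃ p : K[X], aeval y p = G k := by
    intro k
    obtain ⟨w, hw⟩ := hpoly k
    refine H.exists_aeval_eq (M := M + 1)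
      (q := w * ∏ i, (X - C (α i)) ^ poleBound m a k i) ?_ (hGv k)
    have h1 : aeval y (∏ i, (X - C (α i)) ^ poleBound m a k i) = poleFactor m α y a k := by
      simp [poleFactor, map_prod]
    rw [map_mul, hw, h1, hGdef]
    ring
  choose p hp using hp
  have hgp : ∀ k, g k = aeval y (p k) / poleFactor m α y a k := fun k => by
    rw [hp, hGdef]
    simp only
    rw [mul_div_cancel_right₀ _ (H.poleFactor_ne_zero a k)]
  refine ⟨p, fun k => ?_, Finset.sum_congr rfl fun k _ => by rw [hgp]⟩
  by_cases hp0 : p k = 0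
  · rw [hp0]
    exact zero_mem _
  rw [mem_degreeLT, degree_eq_natDegree hp0, Nat.cast_lt, termDim, Int.lt_toNat]
  have h1 := (H.v_term_le_infty hg k).trans (hf H.infty)
  rw [hgp, map_mul, map_div₀, map_pow, H.v_infty_aeval hp0, H.v_infty_poleFactor, H.v_infty_x,
    H.divisor_infty, div_eq_mul_inv, ← exp_neg, ← exp_nsmul, ← exp_add, ← exp_add, exp_le_exp,
    nsmul_eq_mul] at h1
  have h2 : ((p k).natDegree : ℤ) - ∑ i, (poleBound m a k i : ℤ)
      ≤ ((n : ℤ) - r * (k : ℕ)) / m := by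
    rw [Int.le_ediv_iff_mul_le hm]
    linarith
  linarith

/-- The dimension of the Riemann–Roch space of a divisor supported at the totally ramified
places. -/
lemma finite_and_ell_divisor (H : IsKummer m α x y) (a : Fin r → ℕ) (n : ℕ) :
    Module.Finite K (riemannRochSpace (H.divisor a n)) ∧
      ell (H.divisor a n) = ∑ k : Fin m, termDim m a n k := by
  classical
  let φ : (∀ k : Fin m, degreeLT K (termDim m a n k)) →ₗ[K] F :=
    ∑ k : Fin m, ((LinearMap.mulRight K ((poleFactor m α y a k)⁻¹ * x ^ (k : ℕ))).comp
      (aeval y).toLinearMap).comp ((Submodule.subtype _).comp (LinearMap.proj k))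
  have hφ : ∀ p, φ p = ∑ k, aeval y (p k : K[X]) / poleFactor m α y a k * x ^ (k : ℕ) := by
    intro p
    simp only [φ, LinearMap.sum_apply]
    refine Finset.sum_congr rfl fun k _ => ?_
    rw [div_eq_mul_inv, mul_assoc]
    rfl
  have hinj : Function.Injective φ := by
    rw [← LinearMap.ker_eq_bot, LinearMap.ker_eq_bot']
    intro p hp
    rw [hφ] at hp
    funext k
    have h1 := H.eq_zero_of_sum_eq_zero
      (fun k => div_mem (aeval_mem (p k : K[X])) (poleFactor_mem a k)) hp k
    have h2 := (div_eq_zero_iff.1 h1).resolve_right (H.poleFactor_ne_zero a k)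
    exact Subtype.ext (transcendental_iff.1 H.transcendental _ h2)
  have hrange : LinearMap.range φ = riemannRochSpace (H.divisor a n) := by
    apply le_antisymm
    · rintro _ ⟨p, rfl⟩
      rw [hφ]
      exact Submodule.sum_mem _ fun k _ => H.term_mem a n k (p k).2
    · intro f hf
      obtain ⟨p, hp, rfl⟩ := H.exists_eq_sum_of_mem a n hf
      exact ⟨fun k => ⟨p k, hp k⟩, hφ _⟩
  have hfin : ∀ j, Module.Finite K (degreeLT K j) := fun j =>
    Module.Finite.equiv (degreeLTEquiv K j).symm
  rw [ell, ← hrange]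
  refine ⟨inferInstance, ?_⟩
  rw [LinearMap.finrank_range_of_inj hinj, Module.finrank_pi_fintype]
  refine Finset.sum_congr rfl fun k _ => ?_
  rw [(degreeLTEquiv K _).finrank_eq]
  simp

end IsKummer

end KummerDivisor

end

/-! ### The genus -/

noncomputable section

namespace KummerDivisor

open WithZero IsDedekindDomain Polynomial IntermediateField

/-- Multiplication by `z` identifies `ℒ(A)` with `ℒ(A - (z))`. -/
def riemannRochSpaceEquiv {K F : Type*} [Field K] [Field F] [Algebra K F] {A B : Divisor K F}
    {z : F} (hz : z ≠ 0) (h : ∀ Q : Place K F, exp (A Q) * Q.v z = exp (B Q)) :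
    riemannRochSpace A ≃ₗ[K] riemannRochSpace B :=
  LinearEquiv.ofBijective
    ((((LinearMap.mulRight K z).comp (Submodule.subtype _)).codRestrict (riemannRochSpace B)
      fun f Q => by
        rw [← h Q]
        simp only [LinearMap.comp_apply, Submodule.subtype_apply, LinearMap.mulRight_apply, map_mul]
        exact mul_le_mul_left (f.2 Q) _) : riemannRochSpace A →ₗ[K] riemannRochSpace B)
    ⟨fun f g hfg => by
      have := Subtype.ext_iff.1 hfg
      exact Subtype.ext (mul_right_cancel₀ hz this),
    fun f => ⟨⟨(f : F) / z, fun Q => by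
      have hv : 0 < Q.v z := zero_lt_iff.2 ((Valuation.ne_zero_iff _).2 hz)
      rw [map_div₀, div_le_iff₀ hv, h Q]
      exact f.2 Q⟩, Subtype.ext (div_mul_cancel₀ _ hz)⟩⟩

section Arithmetic

variable {r m : ℕ}

lemma not_dvd_mul (hrm : Nat.Coprime r m) {k : ℕ} (hk : 0 < k) (hkm : k < m) : ¬ m ∣ r * k :=
  fun h => absurd (Nat.le_of_dvd hk (hrm.symm.dvd_of_dvd_mul_left h)) (not_le.2 hkm)

/-- By coprimality `rk/m` is not an integer, so the floor of its negative drops by one more. This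
`-1` cancels the `1` in `termDim` for `k > 0`. -/
lemma neg_mul_ediv (hrm : Nat.Coprime r m) {k : ℕ} (hk : 0 < k) (hkm : k < m) :
    (-((r : ℤ) * k)) / m = -((r * k / m : ℕ) : ℤ) - 1 := by
  have hm : 0 < m := by omega
  have h1 := Nat.div_add_mod (r * k) m
  have h2 := Nat.mod_lt (r * k) hm
  have h3 : 0 < r * k % m := Nat.pos_of_ne_zero fun h =>
    not_dvd_mul hrm hk hkm (Nat.dvd_of_mod_eq_zero h)
  generalize r * k / m = q at *
  generalize hu : r * k % m = u at *
  have h4 : (r : ℤ) * k = m * q + u := by exact_mod_cast h1.symm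
  rw [h4, Int.ediv_eq_iff_of_pos (by exact_mod_cast hm)]
  constructor
  · have : (u : ℤ) ≤ m := by exact_mod_cast h2.le
    linarith
  · have : (0 : ℤ) < u := by exact_mod_cast h3
    linarith

/-- The genus of the Kummer extension, as a sum of floors. -/
def floorSum (r m : ℕ) : ℕ := ∑ k ∈ Finset.range m, r * k / m

end Arithmetic

namespace IsKummer

variable {K F : Type*} [Field K] [Field F] [Algebra K F]
variable {r m : ℕ} {α : Fin r → K} {x y : F}

lemma termDim_zero (hm : 0 < m) (a : Fin r → ℕ) (N : ℕ) :
    termDim m a (m * N) 0 = 1 + ∑ i, a i / m + N := by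
  have h1 : ((m * N : ℕ) : ℤ) / m = N := by
    push_cast
    exact Int.mul_ediv_cancel_left _ (by omega)
  simp only [termDim, poleBound, Nat.cast_zero, mul_zero, _root_.sub_zero, add_zero, h1]
  rw [← Nat.cast_sum]
  omega

lemma termDim_pos (hrm : Nat.Coprime r m) (a : Fin r → ℕ) (N : ℕ) {k : ℕ} (hk : 0 < k)
    (hkm : k < m) : termDim m a (m * N) k = N + ∑ i, poleBound m a k i - r * k / m := by
  have h1 : (((m * N : ℕ) : ℤ) - r * k) / m = N - ((r * k / m : ℕ) : ℤ) - 1 := by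
    have : ((m * N : ℕ) : ℤ) - r * k = -((r : ℤ) * k) + N * m := by push_cast; ring
    rw [this, Int.add_mul_ediv_right _ _ (by omega), neg_mul_ediv hrm hk hkm]
    ring
  rw [termDim, h1, ← Nat.cast_sum]
  omega

/-- Since `⌊rk/m⌋ ≤ r ≤ N` for `k < m`, no contribution `N - ⌊rk/m⌋` is truncated. -/
lemma ell_divisor_infty (H : IsKummer m α x y) {N : ℕ} (hN : r ≤ N) :
    (ell (H.divisor 0 (m * N)) : ℤ) = m * N + 1 - floorSum r m := by
  obtain ⟨n, rfl⟩ : ∃ n, m = n + 1 := ⟨m - 1, by have := H.m_pos; omega⟩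
  rw [(H.finite_and_ell_divisor 0 _).2,
    ← Finset.sum_range fun k => termDim (n + 1) (0 : Fin r → ℕ) ((n + 1) * N) k,
    Finset.sum_range_succ', termDim_zero (Nat.succ_pos n), floorSum, Finset.sum_range_succ']
  have h1 : ∀ k ∈ Finset.range n, ((termDim (n + 1) (0 : Fin r → ℕ) ((n + 1) * N) (k + 1) : ℕ) : ℤ)
      = N - (r * (k + 1) / (n + 1) : ℕ) := by
    intro k hk
    rw [Finset.mem_range] at hk
    have hp : ∑ i : Fin r, poleBound (n + 1) (0 : Fin r → ℕ) (k + 1) i = 0 := by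
      refine Finset.sum_eq_zero fun i _ => ?_
      simp only [poleBound, Pi.zero_apply, zero_add]
      exact Nat.div_eq_of_lt (by omega)
    rw [termDim_pos H.coprime _ _ (k := k + 1) (by omega) (by omega), hp]
    have h2 : r * (k + 1) / (n + 1) ≤ r :=
      Nat.div_le_of_le_mul (by rw [mul_comm]; exact Nat.mul_le_mul_right _ (by omega))
    omega
  push_cast
  rw [Finset.sum_congr rfl h1]
  simp only [Pi.zero_apply, Nat.cast_zero, Int.zero_ediv, Finset.sum_sub_distrib,
    Finset.sum_const, Finset.card_range, mul_zero, nsmul_eq_mul]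
  push_cast
  ring

variable [Finite K]

/-- Riemann's inequality with the constant `floorSum r m`. -/
lemma degree_sub_ell_le (H : IsKummer m α x y) (A : Divisor K F) :
    A.degree - (ell A : ℤ) + 1 ≤ floorSum r m := by
  classical
  have := H.finiteDimensional
  have := H.isSeparable
  have hex : ∀ Q : Place K F, ∃ w : K[X], w ≠ 0 ∧ (Q.v y ≤ 1 → Q.v (aeval y w) < 1) := by
    intro Q
    rcases le_or_gt (Q.v y) 1 with h | h
    · obtain ⟨w, hw, hwQ⟩ := exists_aeval_lt_one H.transcendental Q h
      exact ⟨w, hw, fun _ => hwQ⟩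
    · exact ⟨1, one_ne_zero, fun h' => absurd h' (not_le.2 h)⟩
  choose u hu0 hu using hex
  -- The polynomial `w(y)` vanishes at each finite place at least to the order that `A` allows as a
  -- pole.
  let w : K[X] := ∏ Q ∈ A.support, u Q ^ (A Q).toNat
  have hw0 : w ≠ 0 := Finset.prod_ne_zero_iff.2 fun Q _ => pow_ne_zero _ (hu0 Q)
  have hz0 : aeval y w ≠ 0 := fun h => hw0 (transcendental_iff.1 H.transcendental w h)
  have hvz : ∀ Q : Place K F, Q.v (aeval y w) ≠ 0 := fun Q => (Valuation.ne_zero_iff _).2 hz0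
  have hwv : ∀ Q : Place K F, Q.v y ≤ 1 → Q.v (aeval y w) ≤ exp (-(A Q)) ∨ A Q < 0 := by
    intro Q hQ
    rcases lt_or_ge (A Q) 0 with h | h
    · exact Or.inr h
    left
    by_cases hmem : Q ∈ A.support
    · have hlog : Q.v (aeval y (u Q)) ≤ exp (-1) := by
        have h1 := hu Q hQ
        by_cases h0 : Q.v (aeval y (u Q)) = 0
        · rw [h0]
          exact zero_le
        rw [← exp_log h0, ← exp_zero, exp_lt_exp] at h1
        rw [← exp_log h0, exp_le_exp]
        omega
      rw [show w = u Q ^ (A Q).toNat * ∏ Q' ∈ A.support.erase Q, u Q' ^ (A Q').toNat from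
        (Finset.mul_prod_erase _ _ hmem).symm, map_mul, map_mul, map_pow, map_pow]
      refine (mul_le_of_le_one_right' (Q.v_aeval_le_one hQ _)).trans ?_
      refine (pow_le_pow_left' hlog _).trans ?_
      rw [← exp_nsmul, exp_le_exp, nsmul_eq_mul]
      omega
    · rw [Finsupp.notMem_support_iff.1 hmem, neg_zero, exp_zero]
      exact Q.v_aeval_le_one hQ _
  obtain ⟨S, hS, -, hdeg⟩ := exists_finset_zeros H.transcendental hw0
  rw [H.finrank_eq] at hdeg
  have hinfS : H.infty ∉ S := fun h => not_le.2 H.one_lt_infty ((hS _).1 h).1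
  -- The first summand gives `A ≤ B` at infinity; the second meets the hypothesis `r ≤ N` of
  -- `ell_divisor_infty`.
  let N : ℕ := (A H.infty).toNat + r
  let B : Divisor K F := ∑ Q ∈ S, Finsupp.single Q (-log (Q.v (aeval y w)))
    + Finsupp.single H.infty ((m * N : ℕ) : ℤ)
  have hBS : ∀ Q ∈ S, B Q = -log (Q.v (aeval y w)) := by
    intro Q hQ
    have hne : Q ≠ H.infty := fun h => hinfS (h ▸ hQ)
    rw [Finsupp.add_apply, Finsupp.finsetSum_apply, Finsupp.single_eq_of_ne hne, add_zero,
      Finset.sum_eq_single_of_mem Q hQ fun P _ hP => Finsupp.single_eq_of_ne hP.symm,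
      Finsupp.single_eq_same]
  have hBinf : B H.infty = (m * N : ℕ) := by
    rw [Finsupp.add_apply, Finsupp.finsetSum_apply, Finsupp.single_eq_same,
      Finset.sum_eq_zero fun P (hP : P ∈ S) => Finsupp.single_eq_of_ne fun h : H.infty = P =>
        hinfS (h ▸ hP), zero_add]
  have hB0 : ∀ Q, Q ∉ S → Q ≠ H.infty → B Q = 0 := by
    intro Q hQ hne
    rw [Finsupp.add_apply, Finsupp.finsetSum_apply, Finsupp.single_eq_of_ne hne, add_zero]
    exact Finset.sum_eq_zero fun P hP => Finsupp.single_eq_of_ne fun h => hQ (h ▸ hP)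
  have hfinite : ∀ Q : Place K F, Q ≠ H.infty → Q.v y ≤ 1 := fun Q hQ =>
    not_lt.1 fun h => hQ (H.eq_infty h)
  have hAB : A ≤ B := by
    intro Q
    by_cases hQinf : Q = H.infty
    · subst hQinf
      rw [hBinf]
      have h1 : N ≤ m * N := Nat.le_mul_of_pos_left _ H.m_pos
      have h2 : A H.infty ≤ N := by
        simp only [N]
        omega
      exact h2.trans (by exact_mod_cast h1)
    have hQ := hfinite Q hQinf
    by_cases hQS : Q ∈ S
    · rw [hBS Q hQS]
      rcases hwv Q hQ with h | h
      · rw [← exp_log (hvz Q), exp_le_exp] at h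
        omega
      · have h1 := ((hS Q).1 hQS).2
        rw [← exp_log (hvz Q), ← exp_zero, exp_lt_exp] at h1
        omega
    · rw [hB0 Q hQS hQinf]
      rcases hwv Q hQ with h | h
      · have h1 : 1 ≤ Q.v (aeval y w) := not_lt.1 fun h1 => hQS ((hS Q).2 ⟨hQ, h1⟩)
        have h2 := h1.trans h
        rw [← exp_zero, exp_le_exp] at h2
        omega
      · exact h.le
  -- `B` is the zero divisor of `w(y)` plus `mN P_∞`, so multiplication by `w(y)` carries `ℒ(B)`
  -- onto `ℒ(m(N + deg w) P_∞)`. The dimension is thus exact, while the degree of `B` is only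
  -- bounded above; that suffices.
  have hshift : ∀ Q : Place K F, exp (B Q) * Q.v (aeval y w)
      = exp (H.divisor 0 (m * (N + w.natDegree)) Q) := by
    intro Q
    by_cases hQinf : Q = H.infty
    · subst hQinf
      rw [hBinf, H.v_infty_aeval hw0, H.divisor_infty, ← exp_add]
      congr 1
      push_cast
      ring
    have hD : H.divisor 0 (m * (N + w.natDegree)) Q = 0 := by
      by_cases hQi : ∃ i, Q = H.place i
      · obtain ⟨i, rfl⟩ := hQi
        rw [H.divisor_place]
        simp
      · push Not at hQi
        exact H.divisor_of_ne _ _ hQi hQinf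
    rw [hD, exp_zero]
    by_cases hQS : Q ∈ S
    · rw [hBS Q hQS, exp_neg, exp_log (hvz Q)]
      exact inv_mul_cancel₀ (hvz Q)
    · rw [hB0 Q hQS hQinf, exp_zero, one_mul]
      exact (Q.v_aeval_le_one (hfinite Q hQinf) _).antisymm
        (not_lt.1 fun h1 => hQS ((hS Q).2 ⟨hfinite Q hQinf, h1⟩))
  let e := riemannRochSpaceEquiv hz0 hshift
  have hfinD := (H.finite_and_ell_divisor 0 (m * (N + w.natDegree))).1
  have hfinB : Module.Finite K (riemannRochSpace B) := Module.Finite.equiv e.symm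
  have hellB : (ell B : ℤ) = m * (N + w.natDegree : ℕ) + 1 - floorSum r m := by
    rw [← H.ell_divisor_infty (by simp only [N]; omega), ell, e.finrank_eq, ell]
  have hdegB : B.degree ≤ m * (N + w.natDegree : ℕ) := by
    simp only [B, Divisor.degree_add, Divisor.degree_sum, Divisor.degree_single, H.degree_infty]
    push_cast
    linarith
  have hmono := degree_sub_ell_mono H.finite_residueField hAB
  linarith

/-- The genus. -/
lemma genus_eq (H : IsKummer m α x y) : genus K F = floorSum r m := by
  -- Riemann's bound is attained by `m r P_∞`, the smallest multiple covered by `ell_divisor_infty`.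
  refine IsGreatest.csSup_eq ⟨⟨H.divisor 0 (m * r), ?_⟩, ?_⟩
  · simp only [H.ell_divisor_infty le_rfl, H.degree_divisor]
    simp
    ring
  · rintro _ ⟨A, rfl⟩
    exact H.degree_sub_ell_le A

end IsKummer

end KummerDivisor

end

/-! ### Counting functions of the coefficients -/

noncomputable section

namespace KummerDivisor

open WithZero

section Counting

variable {r m : ℕ}

lemma card_filter_le_eq_add {S : Type*} [Fintype S] (f : S → ℕ) (j : ℕ) :
    (Finset.univ.filter fun s => j ≤ f s).card = (Finset.univ.filter fun s => f s = j).card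
      + (Finset.univ.filter fun s => j + 1 ≤ f s).card := by
  classical
  rw [← Finset.card_union_of_disjoint]
  · congr 1
    ext s
    simp only [Finset.mem_filter, Finset.mem_univ, true_and, Finset.mem_union]
    omega
  · rw [Finset.disjoint_filter]
    intro s _ h
    omega

/-- Two positive integer weightings with the same counting function differ by an embedding. -/
lemma exists_embedding_of_card_eq {S T : Type*} [Fintype S] [Fintype T] (a : S → ℕ) (w : T → ℕ)
    (hw : ∀ t, 1 ≤ w t)
    (h : ∀ j, 1 ≤ j → (Finset.univ.filter fun s => j ≤ a s).card
      = (Finset.univ.filter fun t => j ≤ w t).card) :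
    ∃ b : T ↪ S, (∀ t, a (b t) = w t) ∧ ∀ s, (∀ t, b t ≠ s) → a s = 0 := by
  classical
  -- Consecutive differences of the counting functions give the fibre sizes; the embedding is glued
  -- from bijections of the fibres.
  have he : ∀ j, 1 ≤ j → Nonempty ({t // w t = j} ≃ {s // a s = j}) := fun j hj => by
    rw [← Fintype.card_eq, Fintype.card_subtype, Fintype.card_subtype]
    have h1 := card_filter_le_eq_add a j
    have h2 := card_filter_le_eq_add w j
    have h3 := h j hj
    have h4 := h (j + 1) (by omega)
    omega
  let e := fun (j : ℕ) (hj : 1 ≤ j) => (he j hj).some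
  let b : T → S := fun t => (e (w t) (hw t) ⟨t, rfl⟩ : {s // a s = w t})
  have hb : ∀ t j (hj : 1 ≤ j) (ht : w t = j), b t = (e j hj ⟨t, ht⟩ : {s // a s = j}) := by
    rintro t _ hj rfl
    rfl
  have hab : ∀ t, a (b t) = w t := fun t => (e (w t) (hw t) ⟨t, rfl⟩).2
  refine ⟨⟨b, fun t t' htt => ?_⟩, hab, fun s hs => ?_⟩
  · have hww : w t = w t' := by rw [← hab t, ← hab t', htt]
    rw [hb t (w t') (hw t') hww, hb t' (w t') (hw t') rfl] at htt
    exact congrArg Subtype.val ((e (w t') (hw t')).injective (Subtype.ext htt))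
  · by_contra h0
    have hj : 1 ≤ a s := Nat.one_le_iff_ne_zero.2 h0
    refine hs ((e (a s) hj).symm ⟨s, rfl⟩ : {t // w t = a s}) ?_
    change b _ = s
    rw [hb _ (a s) hj ((e (a s) hj).symm ⟨s, rfl⟩).2]
    simp

/-- The values prescribed by a nonnegative vector have the expected number of large entries iff the
vector attains the bounds of the dimension formula and has the right sum. -/
lemma card_filter_eq_iff (hm : 0 < m) (a : Fin r → ℕ) :
    ((∑ i, a i = floorSum r m ∧ (∀ i, a i < m) ∧
      ∀ k, 0 < k → k < m → ∑ i, (a i + k) / m ≤ r * k / m) ↔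
      ∀ j, 1 ≤ j → (Finset.univ.filter fun i => j ≤ a i).card = r * (m - j) / m) := by
  classical
  obtain ⟨n, rfl⟩ : ∃ n, m = n + 1 := ⟨m - 1, by omega⟩
  have hcount : (∀ i, a i < n + 1) → ∀ k, k < n + 1 → ∑ i, (a i + k) / (n + 1)
      = (Finset.univ.filter fun i => n + 1 - k ≤ a i).card := by
    intro ha k hk
    rw [Finset.card_filter]
    refine Finset.sum_congr rfl fun i _ => ?_
    have := ha i
    split_ifs with h
    · rw [Nat.div_eq_iff (by omega)]
      omega
    · exact Nat.div_eq_of_lt (by omega)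
  -- Double counting: `a i` is the number of thresholds `1 ≤ j ≤ n` with `j ≤ a i`, where `j = n -
  -- k`.
  have hsum : (∀ i, a i < n + 1) → ∑ i, a i
      = ∑ k ∈ Finset.range n, (Finset.univ.filter fun i => n + 1 - (k + 1) ≤ a i).card := by
    intro ha
    simp only [Finset.card_filter]
    rw [Finset.sum_comm]
    refine Finset.sum_congr rfl fun i _ => ?_
    rw [← Finset.card_filter]
    have hi := ha i
    have : (Finset.range n).filter (fun k => n + 1 - (k + 1) ≤ a i) = Finset.Ico (n - a i) n := by
      ext k
      simp only [Finset.mem_filter, Finset.mem_range, Finset.mem_Ico]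
      omega
    rw [this, Nat.card_Ico]
    omega
  have hfloor : floorSum r (n + 1) = ∑ k ∈ Finset.range n, r * (k + 1) / (n + 1) := by
    rw [floorSum, Finset.sum_range_succ']
    simp
  constructor
  · rintro ⟨h1, h2, h3⟩ j hj
    rcases lt_or_ge j (n + 1) with hjn | hjn
    · rw [hsum h2, hfloor] at h1
      have hle : ∀ k ∈ Finset.range n, (Finset.univ.filter fun i => n + 1 - (k + 1) ≤ a i).card
          ≤ r * (k + 1) / (n + 1) := fun k hk => by
        rw [Finset.mem_range] at hk
        rw [← hcount h2 (k + 1) (by omega)]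
        exact h3 (k + 1) (by omega) (by omega)
      -- Termwise inequalities with equal sums are equalities.
      have h4 := (Finset.sum_eq_sum_iff_of_le hle).1 h1 (n - j) (Finset.mem_range.2 (by omega))
      have h5 : n + 1 - (n - j + 1) = j := by omega
      have h6 : n - j + 1 = n + 1 - j := by omega
      rwa [h5, h6] at h4
    · rw [Nat.sub_eq_zero_of_le hjn, mul_zero, Nat.zero_div, Finset.card_eq_zero,
        Finset.filter_eq_empty_iff]
      intro i _
      have := h2 i
      omega
  · intro h
    have ha : ∀ i, a i < n + 1 := by
      intro i
      have h1 := h (n + 1) (by omega)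
      rw [Nat.sub_self, mul_zero, Nat.zero_div, Finset.card_eq_zero,
        Finset.filter_eq_empty_iff] at h1
      exact not_le.1 (h1 (Finset.mem_univ i))
    have hk : ∀ k, 0 < k → k < n + 1 →
        (Finset.univ.filter fun i => n + 1 - k ≤ a i).card = r * k / (n + 1) := by
      intro k hk hkn
      have h1 := h (n + 1 - k) (by omega)
      rwa [Nat.sub_sub_self hkn.le] at h1
    refine ⟨?_, ha, fun k hk0 hkn => ?_⟩
    · rw [hsum ha, hfloor]
      refine Finset.sum_congr rfl fun k hkn => hk _ (by omega) ?_
      rw [Finset.mem_range] at hkn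
      omega
    · rw [hcount ha k hkn, hk k hk0 hkn]

/-- As `rj/m` is not an integer, `r - ⌊rj/m⌋` is the ceiling of `r(m - j)/m` and exceeds its floor
by one. -/
lemma lval_eq (hrm : Nat.Coprime r m) {j : ℕ} (hj : 0 < j) (hjm : j < m) :
    lval r m j = r * (m - j) / m + 1 := by
  have hm : 0 < m := by omega
  have h1 := Nat.div_add_mod (r * j) m
  have h2 := Nat.mod_lt (r * j) hm
  have h3 : 0 < r * j % m := Nat.pos_of_ne_zero fun h =>
    not_dvd_mul hrm hj hjm (Nat.dvd_of_mod_eq_zero h)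
  have h4 : r * j / m < r := by
    rw [Nat.div_lt_iff_lt_mul hm]
    exact Nat.mul_lt_mul_of_pos_left hjm (Nat.pos_of_ne_zero (by rintro rfl; simp at h3))
  unfold lval
  have h5 : r * (m - j) / m = r - 1 - r * j / m := by
    rw [Nat.div_eq_iff hm, Nat.mul_sub]
    generalize r * j / m = q at *
    generalize r * j % m = u at *
    obtain ⟨s, rfl⟩ : ∃ s, r = q + 1 + s := ⟨r - q - 1, by omega⟩
    have h6 : q + 1 + s - 1 - q = s := by omega
    rw [h6, ← h1]
    have h7 : (q + 1 + s) * m = m * q + m + s * m := by ring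
    rw [h7]
    omega
  omega

lemma gam_eq_zero_of_eq_one (m : ℕ) : gam 1 m = 0 := by
  simp [gam]

/-- Here `m - (γ + 1) = ⌊m/r⌋`, and `r⌊m/r⌋ < m` because `r ∤ m`. For `r = 1` the subtraction in
`gam` truncates, hence `2 ≤ r`. -/
lemma floor_gam_succ (hrm : Nat.Coprime r m) (hr : 2 ≤ r) (hm : 0 < m) :
    gam r m + 1 = m - m / r ∧ r * (m - (gam r m + 1)) / m = 0 := by
  have h1 : m / r < m := Nat.div_lt_self hm hr
  have h2 : gam r m + 1 = m - m / r := by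
    unfold gam
    omega
  refine ⟨h2, ?_⟩
  rw [h2, Nat.sub_sub_self h1.le]
  refine Nat.div_eq_of_lt (lt_of_le_of_ne (Nat.mul_div_le m r) fun h => ?_)
  have h3 : r ∣ m := ⟨m / r, h.symm⟩
  have h4 : r = 1 := Nat.eq_one_of_dvd_coprimes hrm dvd_rfl h3
  omega

/-- The special last case of `sval` fits the same difference, since the floor at `γ + 1` is `0`. The
sum of the `s_j` therefore telescopes. -/
lemma sval_eq (hrm : Nat.Coprime r m) (hr : 2 ≤ r) (hm : 0 < m) {j : ℕ} (hj : 0 < j)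
    (hjg : j ≤ gam r m) : sval r m j = r * (m - j) / m - r * (m - (j + 1)) / m := by
  have hg : gam r m < m := by
    have := Nat.zero_le (m / r)
    unfold gam
    omega
  unfold sval
  split_ifs with h
  · rw [lval_eq hrm hj (by omega), lval_eq hrm (j := j + 1) (by omega) (by omega)]
    omega
  · obtain rfl : j = gam r m := by omega
    rw [lval_eq hrm hj hg, (floor_gam_succ hrm hr hm).2]
    omega

lemma sum_sval_eq (hrm : Nat.Coprime r m) (hr : 0 < r) (hm : 0 < m) {j : ℕ} (hj : 1 ≤ j) :
    ∑ i ∈ (Finset.Icc 1 (gam r m)).filter (fun i => j ≤ i), sval r m i = r * (m - j) / m := by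
  have hanti : ∀ i i', i ≤ i' → r * (m - i') / m ≤ r * (m - i) / m := fun i i' h =>
    Nat.div_le_div_right (Nat.mul_le_mul_left _ (by omega))
  rcases Nat.lt_or_ge r 2 with hr1 | hr2
  · obtain rfl : r = 1 := by omega
    rw [gam_eq_zero_of_eq_one, one_mul, Nat.div_eq_of_lt (by omega)]
    simp
  have hg := (floor_gam_succ hrm hr2 hm).2
  have hset : (Finset.Icc 1 (gam r m)).filter (fun i => j ≤ i) = Finset.Ico j (gam r m + 1) := by
    ext i
    simp only [Finset.mem_filter, Finset.mem_Icc, Finset.mem_Ico]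
    omega
  rw [hset]
  rcases Nat.lt_or_ge (gam r m + 1) j with h | h
  · have := hanti _ _ h.le
    rw [Finset.Ico_eq_empty (by omega), Finset.sum_empty]
    exact (Nat.le_zero.1 (this.trans hg.le)).symm
  have htel : ∀ n, j ≤ n → n ≤ gam r m + 1 →
      ∑ i ∈ Finset.Ico j n, sval r m i + r * (m - n) / m = r * (m - j) / m := by
    intro n hn
    induction n, hn using Nat.le_induction with
    | base => simp
    | succ n hn ih =>
      intro hng
      rw [Finset.sum_Ico_succ_top hn, sval_eq hrm hr2 hm (by omega) (by omega)]
      have h1 := ih (by omega)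
      have h2 := hanti n (n + 1) (by omega)
      omega
  have := htel _ h le_rfl
  rwa [hg, add_zero] at this

lemma card_filter_sigma (hrm : Nat.Coprime r m) (hr : 0 < r) (hm : 0 < m) {j : ℕ} (hj : 1 ≤ j) :
    (Finset.univ.filter fun t : Σ j : Finset.Icc 1 (gam r m), Fin (sval r m j) =>
      j ≤ (t.1 : ℕ)).card = r * (m - j) / m := by
  classical
  rw [← sum_sval_eq hrm hr hm hj, Finset.card_filter, Fintype.sum_sigma, Finset.sum_filter,
    ← Finset.sum_coe_sort (Finset.Icc 1 (gam r m))]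
  refine Finset.sum_congr rfl fun i _ => ?_
  split_ifs <;> simp

/-- For `t < r` one has `j ≤ ⌊tm/r⌋ ⇔ jr ≤ tm ⇔ (r - t)m ≤ r(m - j) ⇔ r - t ≤ ⌊r(m - j)/m⌋`; for `j
≥ m` the outer two conditions both fail. So the admissible `t` are the last `⌊r(m - j)/m⌋`. -/
lemma card_filter_Icc (hr : 0 < r) (hm : 0 < m) {j : ℕ} (hj : 1 ≤ j) :
    (Finset.univ.filter fun t : Finset.Icc 1 (r - 1) => j ≤ (t : ℕ) * m / r).card
      = r * (m - j) / m := by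
  classical
  set q := r * (m - j) / m with hq
  have hqr : q < r := by
    rw [hq, Nat.div_lt_iff_lt_mul hm]
    exact Nat.mul_lt_mul_of_pos_left (by omega) hr
  have h1 : (Finset.Icc 1 (r - 1)).filter (fun t => j ≤ t * m / r) = Finset.Ico (r - q) r := by
    ext t
    simp only [Finset.mem_filter, Finset.mem_Icc, Finset.mem_Ico]
    have key : t < r → (j ≤ t * m / r ↔ r - t ≤ q) := by
      intro ht
      rw [Nat.le_div_iff_mul_le hr, hq, Nat.le_div_iff_mul_le hm]
      obtain ⟨s, rfl⟩ : ∃ s, r = t + s := ⟨r - t, by omega⟩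
      rw [Nat.add_sub_cancel_left]
      rcases Nat.lt_or_ge j m with hjm | hjm
      · obtain ⟨u, rfl⟩ : ∃ u, m = j + u := ⟨m - j, by omega⟩
        rw [Nat.add_sub_cancel_left]
        constructor <;> intro h <;> nlinarith
      · rw [Nat.sub_eq_zero_of_le hjm, mul_zero]
        constructor
        · intro h
          exfalso
          have : t * m < m * (t + s) := by nlinarith
          nlinarith [Nat.mul_le_mul_right (t + s) hjm]
        · intro h
          have : 0 < s * m := Nat.mul_pos (by omega) hm
          omega
    constructor
    · rintro ⟨⟨h1, h2⟩, h3⟩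
      have := (key (by omega)).1 h3
      omega
    · rintro ⟨h1, h2⟩
      exact ⟨by omega, (key h2).2 (by omega)⟩
  have h2 : (Finset.univ.filter fun t : Finset.Icc 1 (r - 1) => j ≤ (t : ℕ) * m / r).card
      = ((Finset.Icc 1 (r - 1)).filter (fun t => j ≤ t * m / r)).card := by
    rw [Finset.card_filter, Finset.card_filter, ← Finset.sum_coe_sort (Finset.Icc 1 (r - 1))]
  rw [h2, h1, Nat.card_Ico, Nat.sub_sub_self hqr.le]

/-- The value is `⌊r(⌊m/r⌋ + 1)/m⌋`. If `r < m`, the numerator lies between `m` and `m + r < 2m`; if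
`r > m`, then `⌊m/r⌋ = 0`. -/
lemma sval_gam (hrm : Nat.Coprime r m) (hr : 0 < r) (hm : 0 < m) (hg : 1 ≤ gam r m) :
    sval r m (gam r m) = max 1 (r / m) := by
  have hr2 : 2 ≤ r := by
    by_contra h
    obtain rfl : r = 1 := by omega
    rw [gam_eq_zero_of_eq_one] at hg
    omega
  obtain ⟨h1, h2⟩ := floor_gam_succ hrm hr2 hm
  rw [sval_eq hrm hr2 hm hg le_rfl, h2, Nat.sub_zero]
  have h3 : m - gam r m = m / r + 1 := by
    have := Nat.div_lt_self hm hr2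
    have := Nat.zero_le (m / r)
    omega
  rw [h3]
  rcases lt_trichotomy r m with h | rfl | h
  · rw [Nat.div_eq_of_lt h, max_eq_left (by omega), Nat.div_eq_iff hm]
    have h4 := Nat.lt_mul_div_succ m hr
    have h5 := Nat.mul_div_le m r
    rw [mul_add] at h4 ⊢
    omega
  · rw [Nat.coprime_self] at hrm
    omega
  · rw [Nat.div_eq_of_lt h, zero_add, mul_one, max_eq_right]
    exact (Nat.one_le_div_iff hm).2 h.le

end Counting

end KummerDivisor

end

/-! ### The classification of the divisors -/

noncomputable section

namespace KummerDivisor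

open WithZero

namespace IsKummer

variable {K F : Type*} [Field K] [Field F] [Algebra K F]
variable {r m : ℕ} {α : Fin r → K} {x y : F}

/-- The constants already contribute `1`, so all remaining summands of the dimension formula must
vanish; truncated subtraction plays the role of `max(0, ·)`. -/
lemma ell_divisor_eq_one_iff (H : IsKummer m α x y) (a : Fin r → ℕ) :
    ell (H.divisor a 0) = 1 ↔
      (∀ i, a i < m) ∧ ∀ k, 0 < k → k < m → ∑ i, (a i + k) / m ≤ r * k / m := by
  have hm := H.m_pos
  have hell : ell (H.divisor a 0) = 1 + ∑ i, a i / m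
      + ∑ k ∈ Finset.range (m - 1), (∑ i, (a i + (k + 1)) / m - r * (k + 1) / m) := by
    have h0 := (H.finite_and_ell_divisor a (m * 0)).2
    rw [← Finset.sum_range fun k => termDim m a (m * 0) k] at h0
    rw [show Finset.range m = Finset.range (m - 1 + 1) by rw [Nat.sub_add_cancel hm],
      Finset.sum_range_succ', termDim_zero hm, mul_zero] at h0
    rw [h0, add_comm, add_zero]
    congr 1
    refine Finset.sum_congr rfl fun k hk => ?_
    rw [Finset.mem_range] at hk
    have := termDim_pos H.coprime a 0 (k := k + 1) (by omega) (by omega)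
    rw [mul_zero, zero_add] at this
    exact this
  rw [hell]
  constructor
  · intro h
    have h1 : ∑ i, a i / m = 0 := by omega
    have h2 : ∑ k ∈ Finset.range (m - 1), (∑ i, (a i + (k + 1)) / m - r * (k + 1) / m) = 0 := by
      omega
    rw [Finset.sum_eq_zero_iff] at h1 h2
    refine ⟨fun i => (Nat.div_eq_zero_iff_lt hm).1 (h1 i (Finset.mem_univ i)), fun k hk hkm => ?_⟩
    have h3 := h2 (k - 1) (Finset.mem_range.2 (by omega))
    rw [Nat.sub_add_cancel hk] at h3
    exact Nat.sub_eq_zero_iff_le.1 h3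
  · rintro ⟨h1, h2⟩
    have h3 : ∀ k ∈ Finset.range (m - 1), ∑ i, (a i + (k + 1)) / m - r * (k + 1) / m = 0 := by
      intro k hk
      rw [Finset.mem_range] at hk
      exact Nat.sub_eq_zero_of_le (h2 (k + 1) (by omega) (by omega))
    simp [Finset.sum_eq_zero fun i _ => Nat.div_eq_of_lt (h1 i), Finset.sum_eq_zero h3]

lemma eq_divisor (H : IsKummer m α x y) {A : Divisor K F} (hA : 0 ≤ A)
    (hsupp : ∀ Q ∈ A.support, ∃ b : K, ∏ i, (b - α i) = 0 ∧ Q.IsAt x y 0 b) :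
    A = H.divisor (fun i => (A (H.place i)).toNat) 0 := by
  ext Q
  have hzero : (∀ i, Q ≠ H.place i) → A Q = 0 := by
    intro hQ
    by_contra h0
    obtain ⟨b, hb, hat⟩ := hsupp Q (Finsupp.mem_support_iff.2 h0)
    obtain ⟨i, -, hi⟩ := Finset.prod_eq_zero_iff.1 hb
    rw [_root_.sub_eq_zero] at hi
    subst hi
    exact hQ i ((H.isAt_iff i Q).1 hat)
  by_cases hQi : ∃ i, Q = H.place i
  · obtain ⟨i, rfl⟩ := hQi
    have := hA (H.place i)
    rw [Finsupp.coe_zero, Pi.zero_apply] at this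
    rw [H.divisor_place]
    omega
  · push Not at hQi
    rw [hzero hQi]
    by_cases hQ : Q = H.infty
    · rw [hQ, H.divisor_infty, Nat.cast_zero]
    · rw [H.divisor_of_ne _ _ hQi hQ]

lemma isEffective_divisor (H : IsKummer m α x y) (a : Fin r → ℕ) :
    0 ≤ H.divisor a 0 ∧
      ∀ Q ∈ (H.divisor a 0).support, ∃ b : K, ∏ i, (b - α i) = 0 ∧ Q.IsAt x y 0 b := by
  constructor
  · refine add_nonneg (Finset.sum_nonneg fun i _ => ?_) ?_ <;> simp
  · intro Q hQ
    rw [Finsupp.mem_support_iff] at hQ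
    by_cases hQi : ∃ i, Q = H.place i
    · obtain ⟨i, hi⟩ := hQi
      exact ⟨α i, Finset.prod_eq_zero (Finset.mem_univ i) (sub_self _), (H.isAt_iff i Q).2 hi⟩
    · push Not at hQi
      refine absurd ?_ hQ
      by_cases hQ : Q = H.infty
      · rw [hQ, H.divisor_infty, Nat.cast_zero]
      · rw [H.divisor_of_ne _ _ hQi hQ]

variable [Finite K]

/-- The effective non-special divisors of degree `g` over the zeros of `x`, through the number of
coefficients that are at least `j`. -/
lemma isEffectiveNonspecialOverZero_iff (H : IsKummer m α x y) (A : Divisor K F) :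
    IsEffectiveNonspecialOverZero α x y A ↔ ∃ a : Fin r → ℕ, A = H.divisor a 0 ∧
      ∀ j, 1 ≤ j → (Finset.univ.filter fun i => j ≤ a i).card = r * (m - j) / m := by
  have key : ∀ a : Fin r → ℕ, (IsNonspecial (H.divisor a 0) ∧
      (H.divisor a 0).degree = genus K F) ↔
      ∀ j, 1 ≤ j → (Finset.univ.filter fun i => j ≤ a i).card = r * (m - j) / m := by
    intro a
    rw [← card_filter_eq_iff H.m_pos, ← H.ell_divisor_eq_one_iff, IsNonspecial, indexOfSpecialty,
      H.genus_eq, H.degree_divisor, ← Nat.cast_sum]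
    omega
  constructor
  · rintro ⟨h1, h2, h3, h4⟩
    have hA := H.eq_divisor h1 h4
    refine ⟨_, hA, (key _).1 ?_⟩
    rw [← hA]
    exact ⟨h2, h3⟩
  · rintro ⟨a, rfl, ha⟩
    obtain ⟨h2, h3⟩ := (key a).2 ha
    exact ⟨(H.isEffective_divisor a).1, h2, h3, (H.isEffective_divisor a).2⟩

/-- Any family of positive weights with the right counting function parametrizes the divisors, so
both descriptions in the theorem are instances of this one. -/
lemma isEffectiveNonspecialOverZero_iff_exists_embedding (H : IsKummer m α x y) {T : Type*}
    [Fintype T] (w : T → ℕ) (hw : ∀ t, 1 ≤ w t)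
    (hcount : ∀ j, 1 ≤ j → (Finset.univ.filter fun t => j ≤ w t).card = r * (m - j) / m)
    (A : Divisor K F) :
    IsEffectiveNonspecialOverZero α x y A ↔
      ∃ b : T ↪ Fin r, A = ∑ t, (w t : ℤ) • Finsupp.single (H.place (b t)) 1 := by
  classical
  have hdiv : ∀ (a : Fin r → ℕ) (b : T ↪ Fin r), (∀ t, a (b t) = w t) →
      (∀ i, (∀ t, b t ≠ i) → a i = 0) →
      H.divisor a 0 = ∑ t, (w t : ℤ) • Finsupp.single (H.place (b t)) 1 := by
    intro a b hab hb
    rw [divisor, Nat.cast_zero, Finsupp.single_zero, add_zero]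
    symm
    refine Fintype.sum_of_injective b b.injective _ _ (fun i hi => ?_) fun t => ?_
    · rw [hb i fun t ht => hi ⟨t, ht⟩, Nat.cast_zero, Finsupp.single_zero]
    · rw [hab, Finsupp.smul_single, smul_eq_mul, mul_one]
  rw [H.isEffectiveNonspecialOverZero_iff]
  constructor
  · rintro ⟨a, rfl, ha⟩
    obtain ⟨b, hab, hb⟩ := exists_embedding_of_card_eq a w hw fun j hj => by
      rw [ha j hj, hcount j hj]
    exact ⟨b, hdiv a b hab hb⟩
  · rintro ⟨b, rfl⟩
    -- The coefficient vector is `w` carried along `b`, with default `0` off the image; thresholds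
    -- `j ≥ 1` do not see the zeros.
    have hab : ∀ t, Function.extend b w 0 (b t) = w t := fun t => b.injective.extend_apply _ _ t
    have hb : ∀ i, (∀ t, b t ≠ i) → Function.extend b w 0 i = 0 := fun i hi =>
      Function.extend_apply' _ _ _ fun ⟨t, ht⟩ => hi t ht
    refine ⟨Function.extend b w 0, (hdiv _ b hab hb).symm, fun j hj => ?_⟩
    rw [← hcount j hj, ← Finset.card_map b]
    congr 1
    ext i
    simp only [Finset.mem_filter, Finset.mem_univ, true_and, Finset.mem_map]
    constructor
    · intro h
      by_cases hi : ∃ t, b t = i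
      · obtain ⟨t, rfl⟩ := hi
        rw [hab] at h
        exact ⟨t, h, rfl⟩
      · push Not at hi
        rw [hb i hi] at h
        omega
    · rintro ⟨t, ht, rfl⟩
      rwa [hab]

end IsKummer

end KummerDivisor

end

theorem mainTheorem1 {K F : Type*} [Field K] [Finite K] [Field F] [Algebra K F]
    (r m : ℕ) (hr : 0 < r) (hrm : Nat.Coprime r m) (hm : (m : K) ≠ 0)
    (α : Fin r → K) (hα : Function.Injective α)
    (x y : F) (hy : Transcendental K y)
    (hgen : IntermediateField.adjoin K {x, y} = ⊤)
    (hxy : ∏ i, (y - algebraMap K F (α i)) = x ^ m) :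
    -- the closed form of the last multiplicity count
    (1 ≤ KummerDivisor.gam r m →
      KummerDivisor.sval r m (KummerDivisor.gam r m) = max 1 (r / m)) ∧
    -- `P i` is the place `P_{0 b}` with `b = α i`
    ∃ P : Fin r → KummerDivisor.Place K F,
      (∀ (i : Fin r) (Q : KummerDivisor.Place K F), Q.IsAt x y 0 (α i) ↔ Q = P i) ∧
      (∀ A : KummerDivisor.Divisor K F,
        KummerDivisor.IsEffectiveNonspecialOverZero α x y A ↔
          ∃ b : (Σ j : Finset.Icc 1 (KummerDivisor.gam r m),
              Fin (KummerDivisor.sval r m j)) ↪ Fin r,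
            A = ∑ j : Finset.Icc 1 (KummerDivisor.gam r m),
              ((j : ℕ) : ℤ) • ∑ i : Fin (KummerDivisor.sval r m j),
                Finsupp.single (P (b ⟨j, i⟩)) 1) ∧
      (r < m → ∀ A : KummerDivisor.Divisor K F,
        KummerDivisor.IsEffectiveNonspecialOverZero α x y A ↔
          ∃ b : Finset.Icc 1 (r - 1) ↪ Fin r,
            A = ∑ j : Finset.Icc 1 (r - 1),
              (((j : ℕ) * m / r : ℕ) : ℤ) • Finsupp.single (P (b j)) 1) := by
  have H : KummerDivisor.IsKummer m α x y := ⟨hr, hrm, hm, hα, hy, hgen, hxy⟩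
  refine ⟨KummerDivisor.sval_gam hrm hr H.m_pos, H.place, H.isAt_iff, fun A => ?_,
    fun hlt A => ?_⟩
  · rw [H.isEffectiveNonspecialOverZero_iff_exists_embedding
      (T := Σ j : Finset.Icc 1 (KummerDivisor.gam r m), Fin (KummerDivisor.sval r m j))
      (fun t => (t.1 : ℕ)) (fun t => (Finset.mem_Icc.1 t.1.2).1)
      fun j hj => KummerDivisor.card_filter_sigma hrm hr H.m_pos hj]
    refine exists_congr fun b => ?_
    rw [Fintype.sum_sigma]
    simp only [Finset.smul_sum]
  · refine H.isEffectiveNonspecialOverZero_iff_exists_embedding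
      (fun t : Finset.Icc 1 (r - 1) => (t : ℕ) * m / r) (fun t => ?_)
      (fun j hj => KummerDivisor.card_filter_Icc hr H.m_pos hj) A
    -- Here `r < m` enters: it makes every weight `⌊tm/r⌋` positive.
    rw [Nat.one_le_div_iff hr]
    exact hlt.le.trans (Nat.le_mul_of_pos_left m (Finset.mem_Icc.1 t.2).1)
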